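/- Let $J$ and $E$ be the unit rhombuses (side length $1$, acute angle $\pi/3$) in the plane with vertices $$J:\ (0,0),\ \left(-\tfrac12,-\tfrac{\sqrt3}{2}\right),\ \left(\tfrac12,-\tfrac{\sqrt3}{2}\right),\ (1,0),\qquad E:\ \left(\tfrac32,\tfrac{\sqrt3}{2}\right),\ \left(\tfrac52,\tfrac{\sqrt3}{2}\right),\ (2,\sqrt3),\ (1,\sqrt3).$$ (Two unit regular hexagons sharing a side, centred at $(0,0)$ and $\left(\tfrac32,\tfrac{\sqrt3}{2}\right)$, are each cut in the same way into three unit rhombuses meeting at the centre; $J$ is one of the rhombuses of the first hexagon and $E$ one of the second.) Let $X$ and $Y$ be independent random points, uniformly distributed in the interiors of $J$ and $E$ respectively. Then the Euclidean distance $D=|X-Y|$ has a probability density function, and it is given by $f_{D_6}(d)=2d\,g(d)$, where - for $1\le d\le\sqrt3$: $g(d)=-\left(\frac{d^2}{3\sqrt3}+\frac1{\sqrt3}\right)\arcsin\frac{\sqrt3}{2d}+\left(\frac16+\frac{\pi}{9\sqrt3}\right)d^2-\frac5{12}\sqrt{4d^2-3}+\frac{\pi}{3\sqrt3}+\frac14$;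 - for $\sqrt3\le d\le2$: $g(d)=\left(\frac{2d^2}{3\sqrt3}+\frac4{\sqrt3}\right)\arcsin\frac{\sqrt3}{d}+\left(\frac2{\sqrt3}-\frac{d^2}{3\sqrt3}\right)\arcsin\frac{\sqrt3}{2d}-\left(\frac13+\frac{2\pi}{9\sqrt3}\right)d^2+\frac7{12}\sqrt{4d^2-3}+2\sqrt{d^2-3}-\frac{13\pi}{6\sqrt3}-\frac54$; - for $2\le d\le\frac{3\sqrt3}2$: $g(d)=\frac{d^2}{3\sqrt3}\arcsin\frac{\sqrt3}{d}+\left(\frac2{\sqrt3}-\frac{d^2}{3\sqrt3}\right)\arcsin\frac{\sqrt3}{2d}-\left(\frac16+\frac{\pi}{9\sqrt3}\right)d^2+\frac7{12}\sqrt{4d^2-3}+\frac{\sqrt{d^2-3}}3-\frac{5\pi}{6\sqrt3}-\frac14$; - for $\frac{3\sqrt3}2\le d\le\sqrt7$: $g(d)=\frac{d^2}{3\sqrt3}\arcsin\frac{\sqrt3}{d}+\left(\frac2{\sqrt3}-\frac{d^2}{3\sqrt3}\right)\arcsin\frac{\sqrt3}{2d}-\left(\frac{2d^2}{3\sqrt3}+3\sqrt3\right)\arcsin\frac{3\sqrt3}{2d}+\left(\frac{2\pi}{9\sqrt3}-\frac16\right)d^2+\frac7{12}\sqrt{4d^2-3}+\frac{\sqrt{d^2-3}}3-\frac32\sqrt{4d^2-27}+\frac{11\pi}{3\sqrt3}-\frac14$;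 - for $\sqrt7\le d\le3$: $g(d)=\left(\frac{d^2}{3\sqrt3}-\frac4{\sqrt3}\right)\arcsin\frac{\sqrt3}{d}-\left(\frac{d^2}{3\sqrt3}+\frac1{2\sqrt3}\right)\arcsin\frac{\sqrt3}{2d}-\left(\frac{2d^2}{3\sqrt3}+\frac{7\sqrt3}2\right)\arcsin\frac{3\sqrt3}{2d}+\left(\frac13+\frac{2\pi}{9\sqrt3}\right)d^2-\frac{\sqrt{4d^2-3}}4-\sqrt{d^2-3}-\frac53\sqrt{4d^2-27}+\frac{11\pi}{2\sqrt3}+\frac{13}4$; - for $3\le d\le2\sqrt3$: $g(d)=\left(\frac{d^2}{3\sqrt3}-\frac4{\sqrt3}\right)\arcsin\frac{\sqrt3}{d}-\left(\frac{d^2}{3\sqrt3}+\frac1{2\sqrt3}\right)\arcsin\frac{\sqrt3}{2d}+\frac{5\sqrt3}2\arcsin\frac{3\sqrt3}{2d}-\frac{\sqrt{4d^2-3}}4-\sqrt{d^2-3}+\frac56\sqrt{4d^2-27}-\frac{\pi}{2\sqrt3}-\frac54$; - for $2\sqrt3\le d\le\sqrt{13}$: $g(d)=\left(\frac{d^2}{3\sqrt3}+\frac8{\sqrt3}\right)\arcsin\frac{2\sqrt3}{d}-\left(\frac{d^2}{3\sqrt3}+\frac1{2\sqrt3}\right)\arcsin\frac{\sqrt3}{2d}+\frac{5\sqrt3}2\arcsin\frac{3\sqrt3}{2d}-\left(\frac16+\frac{\pi}{9\sqrt3}\right)d^2-\frac{\sqrt{4d^2-3}}4+\frac56\sqrt{4d^2-27}+2\sqrt{d^2-12}-\frac{31\pi}{6\sqrt3}-\frac94$;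 - otherwise: $g(d)=0$. In particular $f_{D_6}$ is well defined (adjacent pieces agree at their common end points) and nonnegative. -/

import Mathlib

/-- The Euclidean plane. -/
abbrev Plane : Type := EuclideanSpace ℝ (Fin 2)

/-- The open parallelogram with vertex `p` and edge vectors `u`, `v`. -/
def openParallelogram (p u v : Plane) : Set Plane :=
  {x | ∃ s ∈ Set.Ioo (0 : ℝ) 1, ∃ t ∈ Set.Ioo (0 : ℝ) 1, x = p + s • u + t • v}

/-- The edge vector of length one in direction `0`. -/
noncomputable def edge0 : Plane := !₂[1, 0]

/-- The edge vector of length one in direction `2π/3`. -/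
noncomputable def edge1 : Plane := !₂[-(1 / 2), √3 / 2]

/-- The edge vector of length one in direction `4π/3`. -/
noncomputable def edge2 : Plane := !₂[-(1 / 2), -(√3 / 2)]

/-- The centre of the first unit hexagon. -/
noncomputable def centre₁ : Plane := !₂[0, 0]

/-- The centre of the second unit hexagon, which shares a side with the first one. -/
noncomputable def centre₂ : Plane := !₂[3 / 2, √3 / 2]

/-- Each unit hexagon with centre `c` and vertices `c + (cos (kπ/3), sin (kπ/3))` is cut into the
three unit rhombuses (side one, acute angle `π/3`) with vertex `c` and edge vectors
`edge0, edge1`, or `edge1, edge2`, or `edge2, edge0`.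
`J` is the rhombus of the first hexagon with edge vectors `edge2, edge0`; its vertices are
`(0, 0)`, `(-1/2, -√3/2)`, `(1/2, -√3/2)`, `(1, 0)`. -/
noncomputable def rhombusJ : Set Plane := openParallelogram centre₁ edge2 edge0

/-- `E` is the rhombus of the second hexagon with edge vectors `edge0, edge1`; its vertices are
`(3/2, √3/2)`, `(5/2, √3/2)`, `(2, √3)`, `(1, √3)`. -/
noncomputable def rhombusE : Set Plane := openParallelogram centre₂ edge0 edge1

/-- The factor of `2 * d` in the density on `[1, √3]`. -/
noncomputable def pieceJE1 (d : ℝ) : ℝ :=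
  -(d ^ 2 / (3 * √3) + 1 / √3) * Real.arcsin (√3 / (2 * d))
    + (1 / 6 + Real.pi / (9 * √3)) * d ^ 2 - 5 / 12 * √(4 * d ^ 2 - 3)
    + Real.pi / (3 * √3) + 1 / 4

/-- The factor of `2 * d` in the density on `[√3, 2]`. -/
noncomputable def pieceJE2 (d : ℝ) : ℝ :=
  (2 * d ^ 2 / (3 * √3) + 4 / √3) * Real.arcsin (√3 / d)
    + (2 / √3 - d ^ 2 / (3 * √3)) * Real.arcsin (√3 / (2 * d))
    - (1 / 3 + 2 * Real.pi / (9 * √3)) * d ^ 2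
    + 7 / 12 * √(4 * d ^ 2 - 3) + 2 * √(d ^ 2 - 3)
    - 13 * Real.pi / (6 * √3) - 5 / 4

/-- The factor of `2 * d` in the density on `[2, 3√3/2]`. -/
noncomputable def pieceJE3 (d : ℝ) : ℝ :=
  d ^ 2 / (3 * √3) * Real.arcsin (√3 / d)
    + (2 / √3 - d ^ 2 / (3 * √3)) * Real.arcsin (√3 / (2 * d))
    - (1 / 6 + Real.pi / (9 * √3)) * d ^ 2
    + 7 / 12 * √(4 * d ^ 2 - 3) + √(d ^ 2 - 3) / 3
    - 5 * Real.pi / (6 * √3) - 1 / 4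

/-- The factor of `2 * d` in the density on `[3√3/2, √7]`. -/
noncomputable def pieceJE4 (d : ℝ) : ℝ :=
  d ^ 2 / (3 * √3) * Real.arcsin (√3 / d)
    + (2 / √3 - d ^ 2 / (3 * √3)) * Real.arcsin (√3 / (2 * d))
    - (2 * d ^ 2 / (3 * √3) + 3 * √3) * Real.arcsin (3 * √3 / (2 * d))
    + (2 * Real.pi / (9 * √3) - 1 / 6) * d ^ 2
    + 7 / 12 * √(4 * d ^ 2 - 3) + √(d ^ 2 - 3) / 3 - 3 / 2 * √(4 * d ^ 2 - 27)
    + 11 * Real.pi / (3 * √3) - 1 / 4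

/-- The factor of `2 * d` in the density on `[√7, 3]`. -/
noncomputable def pieceJE5 (d : ℝ) : ℝ :=
  (d ^ 2 / (3 * √3) - 4 / √3) * Real.arcsin (√3 / d)
    - (d ^ 2 / (3 * √3) + 1 / (2 * √3)) * Real.arcsin (√3 / (2 * d))
    - (2 * d ^ 2 / (3 * √3) + 7 * √3 / 2) * Real.arcsin (3 * √3 / (2 * d))
    + (1 / 3 + 2 * Real.pi / (9 * √3)) * d ^ 2
    - √(4 * d ^ 2 - 3) / 4 - √(d ^ 2 - 3) - 5 / 3 * √(4 * d ^ 2 - 27)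
    + 11 * Real.pi / (2 * √3) + 13 / 4

/-- The factor of `2 * d` in the density on `[3, 2√3]`. -/
noncomputable def pieceJE6 (d : ℝ) : ℝ :=
  (d ^ 2 / (3 * √3) - 4 / √3) * Real.arcsin (√3 / d)
    - (d ^ 2 / (3 * √3) + 1 / (2 * √3)) * Real.arcsin (√3 / (2 * d))
    + 5 * √3 / 2 * Real.arcsin (3 * √3 / (2 * d))
    - √(4 * d ^ 2 - 3) / 4 - √(d ^ 2 - 3) + 5 / 6 * √(4 * d ^ 2 - 27)
    - Real.pi / (2 * √3) - 5 / 4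

/-- The factor of `2 * d` in the density on `[2√3, √13]`. -/
noncomputable def pieceJE7 (d : ℝ) : ℝ :=
  (d ^ 2 / (3 * √3) + 8 / √3) * Real.arcsin (2 * √3 / d)
    - (d ^ 2 / (3 * √3) + 1 / (2 * √3)) * Real.arcsin (√3 / (2 * d))
    + 5 * √3 / 2 * Real.arcsin (3 * √3 / (2 * d))
    - (1 / 6 + Real.pi / (9 * √3)) * d ^ 2
    - √(4 * d ^ 2 - 3) / 4 + 5 / 6 * √(4 * d ^ 2 - 27) + 2 * √(d ^ 2 - 12)
    - 31 * Real.pi / (6 * √3) - 9 / 4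

/-- The piecewise density; at a common end point of two pieces the left one is used (the theorem
says that the right one has the same value there). -/
noncomputable def densityJE (d : ℝ) : ℝ :=
  if d < 1 then 0
  else if d ≤ √3 then 2 * d * pieceJE1 d
  else if d ≤ 2 then 2 * d * pieceJE2 d
  else if d ≤ 3 * √3 / 2 then 2 * d * pieceJE3 d
  else if d ≤ √7 then 2 * d * pieceJE4 d
  else if d ≤ 3 then 2 * d * pieceJE5 d
  else if d ≤ 2 * √3 then 2 * d * pieceJE6 d
  else if d ≤ √13 then 2 * d * pieceJE7 d
  else 0

/-! Since `edge0 + edge1 + edge2 = 0` and `centre₂ = edge0 - edge2`, the difference of the two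
points is `a • edge2 + b • edge0` with `a = 1 + s + t'` and `b = t - s' + t' - 1`, where `s, t, s',
t'` are independent and uniform on the unit interval. Its squared length is the norm form `a ^ 2 - a
* b + b ^ 2`. Given `t'`, the coordinates `a` and `b` are independent, one uniform and the other
with density a translate of `hat`; integrating over `t'` gives the joint density `diffDensity`.

On the circle of radius `d` the coordinates are `a = 2d/√3 · sin φ` and `b = 2d/√3 · sin (φ + π/3)`,
so polar coordinates give the density of the distance as `2d/√3` times the integral of `diffDensity`
over the circle (`lintegral_diffDensity`). Only `0 < φ < π` matters, because `a > 1` on the support.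

`diffDensity` is a sum of terms living on `a > 1`, `a > 2`, `a > 3`, each a value of `hatPrimitive`
at a function of `b` alone or of `a - b` alone. The reflection `φ ↦ π - φ` preserves `a` and
exchanges `b` with `a - b`; as `hatPrimitive` is half a second difference of squared positive parts,
everything reduces to the integrals of `(b - k)₊ ^ 2` over the arcs `a > i`. These are the
`arcMoment d i k`, and `arcSum` is the resulting combination (`integral_diffDensity`).

The shape of each moment depends on where the lines `a = i` and `b = k` meet: they cross at squared
distance `i ^ 2 - i * k + k ^ 2` from the origin, so comparing this with `d ^ 2` selects the closed
form. The crossings that matter have squared distance 1, 3, 4, 7, 9, 12, 13; together with 27/4,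
where the circle becomes tangent to `a = 3` and `b = 3`, they are the squares of the break points.
Nonnegativity and agreement at break points follow from the single function `arcSum`. -/

open MeasureTheory Set

/-! ### Crossing angles of a circle with lattice lines, and moments of its arcs -/

/-- The angle under which the circle of radius `d` meets the line at signed height `k * √3 / 2`
(saturated if it does not). -/
noncomputable def lineAngle (d k : ℝ) : ℝ := Real.arcsin (k * √3 / (2 * d))

/-- The primitive of `θ ↦ (2 * d / √3 * sin θ - k) ^ 2`, divided by `√3`. -/
noncomputable def arcPrimitive (d k θ : ℝ) : ℝ :=
  ((2 * d / √3) ^ 2 * (θ - Real.sin θ * Real.cos θ) / 2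
    + 2 * k * (2 * d / √3) * Real.cos θ + k ^ 2 * θ) / √3

/-- The second moment of the truncated height `b - k` on the arc `a > i` of the circle of
radius `d`, divided by `√3`. -/
noncomputable def arcMoment (d i k : ℝ) : ℝ :=
  (∫ φ in lineAngle d i..Real.pi - lineAngle d i,
    (max (2 * d / √3 * Real.sin (φ + Real.pi / 3) - k) 0) ^ 2) / √3

theorem sqrt_three_sq : √3 ^ 2 = (3 : ℝ) := Real.sq_sqrt (by norm_num)

theorem lineAngle_neg (d k : ℝ) : lineAngle d (-k) = -lineAngle d k := by
  rw [lineAngle, lineAngle, ← Real.arcsin_neg]; congr 1; ring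

theorem lineAngle_zero (d : ℝ) : lineAngle d 0 = 0 := by simp [lineAngle]

theorem lineAngle_le (d k : ℝ) : lineAngle d k ≤ Real.pi / 2 := Real.arcsin_le_pi_div_two _

theorem neg_le_lineAngle (d k : ℝ) : -(Real.pi / 2) ≤ lineAngle d k :=
  Real.neg_pi_div_two_le_arcsin _

theorem lineAngle_nonneg {d k : ℝ} (hd : 0 < d) (hk : 0 ≤ k) : 0 ≤ lineAngle d k :=
  Real.arcsin_nonneg.2 (by positivity)

/-- With the arcsine saturated, the arc from `lineAngle d k` to `π - lineAngle d k` shrinks to a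
point. Terms of lines that the circle does not reach thus vanish by themselves, and one formula
`arcSum` serves all radii. -/
theorem lineAngle_of_le {d k : ℝ} (hd : 0 < d) (hk : 0 ≤ k) (h : 4 * d ^ 2 ≤ 3 * k ^ 2) :
    lineAngle d k = Real.pi / 2 := by
  apply Real.arcsin_of_one_le
  rw [le_div_iff₀ (by positivity), one_mul]
  refine (pow_le_pow_iff_left₀ (by positivity) (by positivity) two_ne_zero).1 ?_
  nlinarith [sqrt_three_sq]

theorem mul_sin_lineAngle {d k : ℝ} (hd : 0 < d) (h : 3 * k ^ 2 ≤ 4 * d ^ 2) :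
    2 * d / √3 * Real.sin (lineAngle d k) = k := by
  have h3 := sqrt_three_sq
  have : |k * √3 / (2 * d)| ≤ 1 := by
    rw [abs_le_one_iff_mul_self_le_one, div_mul_div_comm, div_le_one (by positivity)]
    nlinarith
  rw [lineAngle, Real.sin_arcsin (abs_le.1 this).1 (abs_le.1 this).2]
  field_simp

theorem mul_cos_lineAngle {d : ℝ} (hd : 0 < d) (k : ℝ) :
    2 * d / √3 * Real.cos (lineAngle d k) = √(4 * d ^ 2 - 3 * k ^ 2) / √3 := by
  have h3 := sqrt_three_sq
  rw [lineAngle, Real.cos_arcsin, div_mul_eq_mul_div]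
  congr 1
  rw [← Real.sqrt_sq (by positivity : 0 ≤ 2 * d), ← Real.sqrt_mul (by positivity)]
  congr 1
  rw [Real.sqrt_sq (by positivity)]
  field_simp
  rw [h3]; ring

theorem two_mul_div_sqrt_three_le {d k : ℝ} (hk : 0 ≤ k) (h : 4 * d ^ 2 ≤ 3 * k ^ 2) :
    2 * d / √3 ≤ k := by
  have h3 := sqrt_three_sq
  rw [div_le_iff₀ (by positivity)]
  refine le_of_abs_le (abs_le_of_sq_le_sq ?_ (by positivity))
  nlinarith

theorem le_mul_sin {d k θ : ℝ} (hd : 0 < d) (h : 3 * k ^ 2 ≤ 4 * d ^ 2 ∨ k ≤ 0)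
    (h1 : lineAngle d k ≤ θ) (h2 : θ ≤ Real.pi - lineAngle d k) :
    k ≤ 2 * d / √3 * Real.sin θ := by
  rcases le_or_gt (3 * k ^ 2) (4 * d ^ 2) with h' | h'
  swap
  -- The line does not meet the circle and lies on the negative side, so every value of the sine
  -- clears it.
  · have hk : k ≤ 0 := h.resolve_left (not_le.2 h')
    have hR := two_mul_div_sqrt_three_le (d := d) (neg_nonneg.2 hk) (by linarith [neg_sq k])
    have : 0 ≤ 2 * d / √3 := by positivity
    nlinarith [Real.neg_one_le_sin θ]
  replace h := h'
  have h0 := neg_le_lineAngle d k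
  conv_lhs => rw [← mul_sin_lineAngle hd h]
  gcongr
  rcases le_total θ (Real.pi / 2) with h | h
  · exact Real.sin_le_sin_of_le_of_le_pi_div_two h0 h h1
  · rw [← Real.sin_pi_sub θ]
    exact Real.sin_le_sin_of_le_of_le_pi_div_two h0 (by linarith) (by linarith)

theorem mul_sin_le_of_le_lineAngle {d k θ : ℝ} (hd : 0 < d) (h : 3 * k ^ 2 ≤ 4 * d ^ 2)
    (h1 : -(Real.pi / 2) ≤ θ) (h2 : θ ≤ lineAngle d k) :
    2 * d / √3 * Real.sin θ ≤ k := by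
  conv_rhs => rw [← mul_sin_lineAngle hd h]
  gcongr
  exact Real.sin_le_sin_of_le_of_le_pi_div_two h1 (lineAngle_le d k) h2

theorem mul_sin_le_of_lineAngle_le {d k θ : ℝ} (hd : 0 < d) (h : 3 * k ^ 2 ≤ 4 * d ^ 2)
    (h1 : θ ≤ 3 * Real.pi / 2) (h2 : Real.pi - lineAngle d k ≤ θ) :
    2 * d / √3 * Real.sin θ ≤ k := by
  rw [← Real.sin_pi_sub]
  exact mul_sin_le_of_le_lineAngle hd h (by linarith) (by linarith)

theorem integral_sq_eq_arcPrimitive (d k p q : ℝ) :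
    (∫ θ in p..q, (2 * d / √3 * Real.sin θ - k) ^ 2) / √3
      = arcPrimitive d k q - arcPrimitive d k p := by
  rw [← intervalIntegral.integral_div]
  apply intervalIntegral.integral_eq_sub_of_hasDerivAt
  · intro x _
    have := (((((hasDerivAt_id x).sub ((Real.hasDerivAt_sin x).mul
      (Real.hasDerivAt_cos x))).const_mul ((2 * d / √3) ^ 2)).div_const 2).add
      (((Real.hasDerivAt_cos x).const_mul (2 * k * (2 * d / √3))))).add
      ((hasDerivAt_id x).const_mul (k ^ 2)) |>.div_const (√3)
    refine this.congr_deriv ?_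
    congr 1
    linear_combination (2 * d / √3) ^ 2 / 2 * (- Real.sin_sq_add_cos_sq x)
  · apply Continuous.intervalIntegrable; fun_prop

theorem integral_max_eq_integral {d k p q : ℝ} (hpq : p ≤ q)
    (h : ∀ θ ∈ Icc p q, k ≤ 2 * d / √3 * Real.sin θ) :
    ∫ θ in p..q, (max (2 * d / √3 * Real.sin θ - k) 0) ^ 2
      = ∫ θ in p..q, (2 * d / √3 * Real.sin θ - k) ^ 2 := by
  refine intervalIntegral.integral_congr fun θ hθ => ?_
  rw [uIcc_of_le hpq] at hθ
  simp only [max_eq_left (sub_nonneg.2 (h θ hθ))]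

theorem integral_max_eq_zero {d k p q : ℝ} (hpq : p ≤ q)
    (h : ∀ θ ∈ Icc p q, 2 * d / √3 * Real.sin θ ≤ k) :
    ∫ θ in p..q, (max (2 * d / √3 * Real.sin θ - k) 0) ^ 2 = 0 := by
  rw [← intervalIntegral.integral_zero (a := p) (b := q) (μ := volume)]
  refine intervalIntegral.integral_congr fun θ hθ => ?_
  rw [uIcc_of_le hpq] at hθ
  simp [max_eq_right (sub_nonpos.2 (h θ hθ))]

/-- After the shift by `π/3` the integrand is supported where `θ`, modulo full turns, lies between
`lineAngle d k` and `π - lineAngle d k`. Evaluating the moment means comparing these two angles with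
the ends of the arc. -/
theorem arcMoment_eq (d i k : ℝ) :
    arcMoment d i k = (∫ θ in Real.pi / 3 + lineAngle d i..4 * Real.pi / 3 - lineAngle d i,
      (max (2 * d / √3 * Real.sin θ - k) 0) ^ 2) / √3 := by
  rw [arcMoment, intervalIntegral.integral_comp_add_right
    (fun θ => (max (2 * d / √3 * Real.sin θ - k) 0) ^ 2)]
  congr 2 <;> ring

theorem intervalIntegrable_max_sq (d k p q : ℝ) :
    IntervalIntegrable (fun θ => (max (2 * d / √3 * Real.sin θ - k) 0) ^ 2) volume p q := by
  apply Continuous.intervalIntegrable; fun_prop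

theorem arcMoment_of_le_left {d i : ℝ} (hd : 0 < d) (hi : 0 ≤ i) (h : 4 * d ^ 2 ≤ 3 * i ^ 2)
    (k : ℝ) : arcMoment d i k = 0 := by
  rw [arcMoment, lineAngle_of_le hd hi h, sub_half, intervalIntegral.integral_same, zero_div]

theorem arcMoment_of_le_right {d i k : ℝ} (hd : 0 < d) (hk : 0 ≤ k)
    (h : 4 * d ^ 2 ≤ 3 * k ^ 2) : arcMoment d i k = 0 := by
  have hR := two_mul_div_sqrt_three_le hk h
  have := lineAngle_le d i
  rw [arcMoment_eq, integral_max_eq_zero (by linarith), zero_div]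
  intro θ _
  refine le_trans ?_ hR
  exact mul_le_of_le_one_right (by positivity) (Real.sin_le_one θ)

theorem arcMoment_eq_zero {d i k : ℝ} (hd : 0 < d) (hi : 0 ≤ i) (hk : 3 * k ^ 2 ≤ 4 * d ^ 2)
    (h : 2 * Real.pi / 3 ≤ lineAngle d i + lineAngle d k) : arcMoment d i k = 0 := by
  have := lineAngle_le d i
  have := lineAngle_nonneg hd hi
  have := Real.pi_pos
  rw [arcMoment_eq, integral_max_eq_zero (by linarith), zero_div]
  rintro θ ⟨h1, h2⟩
  exact mul_sin_le_of_lineAngle_le hd hk (by linarith) (by linarith)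

theorem arcMoment_full {d i k : ℝ} (hd : 0 < d) (hk : 3 * k ^ 2 ≤ 4 * d ^ 2 ∨ k ≤ 0)
    (h : Real.pi / 3 + lineAngle d k ≤ lineAngle d i) :
    arcMoment d i k = arcPrimitive d k (4 * Real.pi / 3 - lineAngle d i)
      - arcPrimitive d k (Real.pi / 3 + lineAngle d i) := by
  have := lineAngle_le d i
  have := Real.pi_pos
  rw [arcMoment_eq, integral_max_eq_integral (by linarith), integral_sq_eq_arcPrimitive]
  rintro θ ⟨h3, h4⟩
  exact le_mul_sin hd hk (by linarith) (by linarith)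

/-- The generic position: the arc begins where the height already exceeds `k` and leaves that region
before it ends, so the integral stops at the second crossing with `b = k`. -/
theorem arcMoment_left {d i k : ℝ} (hd : 0 < d) (hi : 0 ≤ i) (hk : 3 * k ^ 2 ≤ 4 * d ^ 2)
    (h1 : lineAngle d k ≤ Real.pi / 3 + lineAngle d i)
    (h2 : lineAngle d i ≤ Real.pi / 3 + lineAngle d k)
    (h3 : lineAngle d i + lineAngle d k ≤ 2 * Real.pi / 3) :
    arcMoment d i k = arcPrimitive d k (Real.pi - lineAngle d k)
      - arcPrimitive d k (Real.pi / 3 + lineAngle d i) := by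
  have := lineAngle_nonneg hd hi
  have := Real.pi_pos
  rw [arcMoment_eq, ← intervalIntegral.integral_add_adjacent_intervals
    (intervalIntegrable_max_sq d k _ (Real.pi - lineAngle d k)) (intervalIntegrable_max_sq d k _ _),
    integral_max_eq_integral (by linarith), integral_max_eq_zero (by linarith), add_zero,
    integral_sq_eq_arcPrimitive]
  · rintro θ ⟨h3, h4⟩
    exact mul_sin_le_of_lineAngle_le hd hk (by linarith) (by linarith)
  · rintro θ ⟨h3, h4⟩
    exact le_mul_sin hd (.inl hk) (by linarith) (by linarith)

/-- Here both crossings with `b = k` lie on the arc, which therefore begins and ends below that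
line. -/
theorem arcMoment_inner {d i k : ℝ} (hd : 0 < d) (hi : 0 ≤ i) (hk : 3 * k ^ 2 ≤ 4 * d ^ 2)
    (h : Real.pi / 3 + lineAngle d i ≤ lineAngle d k) :
    arcMoment d i k = arcPrimitive d k (Real.pi - lineAngle d k)
      - arcPrimitive d k (lineAngle d k) := by
  have := lineAngle_nonneg hd hi
  have := Real.pi_pos
  have := lineAngle_le d k
  rw [arcMoment_eq, ← intervalIntegral.integral_add_adjacent_intervals
    (intervalIntegrable_max_sq d k _ (Real.pi - lineAngle d k)) (intervalIntegrable_max_sq d k _ _),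
    ← intervalIntegral.integral_add_adjacent_intervals
    (intervalIntegrable_max_sq d k _ (lineAngle d k)) (intervalIntegrable_max_sq d k _ _),
    integral_max_eq_integral (p := lineAngle d k) (by linarith), integral_max_eq_zero (by linarith),
    integral_max_eq_zero (by linarith), add_zero, zero_add,
    integral_sq_eq_arcPrimitive]
  · rintro θ ⟨h3, h4⟩
    exact mul_sin_le_of_lineAngle_le hd hk (by linarith) (by linarith)
  · rintro θ ⟨h3, h4⟩
    exact mul_sin_le_of_le_lineAngle hd hk (by linarith) (by linarith)
  · rintro θ ⟨h3, h4⟩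
    exact le_mul_sin hd (.inl hk) (by linarith) (by linarith)

/-! ### Values of the primitive at crossing angles -/

theorem arcPrimitive_pi_sub_lineAngle {d k : ℝ} (hd : 0 < d) (h : 3 * k ^ 2 ≤ 4 * d ^ 2) :
    arcPrimitive d k (Real.pi - lineAngle d k) =
      (2 * d ^ 2 / 3 + k ^ 2) * (Real.pi - lineAngle d k) / √3
        - k * √(4 * d ^ 2 - 3 * k ^ 2) / 2 := by
  have hs := mul_sin_lineAngle hd h
  have hc := mul_cos_lineAngle hd k
  have h3 := sqrt_three_sq
  have e : arcPrimitive d k (Real.pi - lineAngle d k) =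
    (4 * d ^ 2 / √3 ^ 2 * (Real.pi - lineAngle d k) / 2 + 2 * d / √3 * Real.sin (lineAngle d k)
      * (2 * d / √3 * Real.cos (lineAngle d k)) / 2
      - 2 * k * (2 * d / √3 * Real.cos (lineAngle d k))
      + k ^ 2 * (Real.pi - lineAngle d k)) / √3 := by
    rw [arcPrimitive, Real.sin_pi_sub, Real.cos_pi_sub]; ring
  rw [e, hs, hc]
  field_simp
  rw [h3]; ring

theorem arcPrimitive_lineAngle {d k : ℝ} (hd : 0 < d) (h : 3 * k ^ 2 ≤ 4 * d ^ 2) :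
    arcPrimitive d k (lineAngle d k) =
      (2 * d ^ 2 / 3 + k ^ 2) * lineAngle d k / √3 + k * √(4 * d ^ 2 - 3 * k ^ 2) / 2 := by
  have hs := mul_sin_lineAngle hd h
  have hc := mul_cos_lineAngle hd k
  have h3 := sqrt_three_sq
  have e : arcPrimitive d k (lineAngle d k) =
    (4 * d ^ 2 / √3 ^ 2 * lineAngle d k / 2 - 2 * d / √3 * Real.sin (lineAngle d k)
      * (2 * d / √3 * Real.cos (lineAngle d k)) / 2
      + 2 * k * (2 * d / √3 * Real.cos (lineAngle d k))
      + k ^ 2 * lineAngle d k) / √3 := by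
    rw [arcPrimitive]; ring
  rw [e, hs, hc]
  field_simp
  rw [h3]; ring

theorem arcPrimitive_add_lineAngle {d i : ℝ} (hd : 0 < d) (h : 3 * i ^ 2 ≤ 4 * d ^ 2) (k : ℝ) :
    arcPrimitive d k (Real.pi / 3 + lineAngle d i) =
      (2 * d ^ 2 / 3 + k ^ 2) * (Real.pi / 3 + lineAngle d i) / √3
        - (d ^ 2 / 6 - i ^ 2 / 4 - i * √(4 * d ^ 2 - 3 * i ^ 2) / 12)
        + k * (√(4 * d ^ 2 - 3 * i ^ 2) / 3 - i) := by
  have hs := mul_sin_lineAngle hd h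
  have hc := mul_cos_lineAngle hd i
  have h3 := sqrt_three_sq
  have hS : √(4 * d ^ 2 - 3 * i ^ 2) ^ 2 = 4 * d ^ 2 - 3 * i ^ 2 := Real.sq_sqrt (by linarith)
  have e : arcPrimitive d k (Real.pi / 3 + lineAngle d i) =
    (4 * d ^ 2 / √3 ^ 2 * (Real.pi / 3 + lineAngle d i) / 2
      - (√3 * (2 * d / √3 * Real.cos (lineAngle d i)) + 2 * d / √3 * Real.sin (lineAngle d i))
      * ((2 * d / √3 * Real.cos (lineAngle d i)) - √3 * (2 * d / √3 * Real.sin (lineAngle d i))) / 8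
      + k * ((2 * d / √3 * Real.cos (lineAngle d i))
        - √3 * (2 * d / √3 * Real.sin (lineAngle d i)))
      + k ^ 2 * (Real.pi / 3 + lineAngle d i)) / √3 := by
    rw [arcPrimitive, Real.sin_add, Real.cos_add, Real.sin_pi_div_three, Real.cos_pi_div_three]; ring
  rw [e, hs, hc]
  field_simp
  generalize √(4 * d ^ 2 - 3 * i ^ 2) = S at *
  generalize √3 = q at *
  have h4 : q ^ 3 = 3 * q := by linear_combination q * h3
  ring_nf
  simp only [h3, h4, hS]
  ring

theorem arcPrimitive_sub_lineAngle {d i : ℝ} (hd : 0 < d) (h : 3 * i ^ 2 ≤ 4 * d ^ 2) (k : ℝ) :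
    arcPrimitive d k (4 * Real.pi / 3 - lineAngle d i) =
      (2 * d ^ 2 / 3 + k ^ 2) * (4 * Real.pi / 3 - lineAngle d i) / √3
        - (d ^ 2 / 6 - i ^ 2 / 4 + i * √(4 * d ^ 2 - 3 * i ^ 2) / 12)
        - k * (√(4 * d ^ 2 - 3 * i ^ 2) / 3 + i) := by
  have hs := mul_sin_lineAngle hd h
  have hc := mul_cos_lineAngle hd i
  have h3 := sqrt_three_sq
  have hS : √(4 * d ^ 2 - 3 * i ^ 2) ^ 2 = 4 * d ^ 2 - 3 * i ^ 2 := Real.sq_sqrt (by linarith)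
  have e : arcPrimitive d k (4 * Real.pi / 3 - lineAngle d i) =
    (4 * d ^ 2 / √3 ^ 2 * (4 * Real.pi / 3 - lineAngle d i) / 2
      - (√3 * (2 * d / √3 * Real.cos (lineAngle d i)) - 2 * d / √3 * Real.sin (lineAngle d i))
      * ((2 * d / √3 * Real.cos (lineAngle d i)) + √3 * (2 * d / √3 * Real.sin (lineAngle d i))) / 8
      - k * ((2 * d / √3 * Real.cos (lineAngle d i))
        + √3 * (2 * d / √3 * Real.sin (lineAngle d i)))
      + k ^ 2 * (4 * Real.pi / 3 - lineAngle d i)) / √3 := by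
    have e1 : 4 * Real.pi / 3 - lineAngle d i = (Real.pi / 3 - lineAngle d i) + Real.pi := by ring
    rw [arcPrimitive, e1, Real.sin_add_pi, Real.cos_add_pi, Real.sin_sub, Real.cos_sub,
      Real.sin_pi_div_three, Real.cos_pi_div_three]; ring
  rw [e, hs, hc]
  field_simp
  generalize √(4 * d ^ 2 - 3 * i ^ 2) = S at *
  generalize √3 = q at *
  have h4 : q ^ 3 = 3 * q := by linear_combination q * h3
  ring_nf
  simp only [h3, h4, hS]
  ring

/-! ### Order of the crossing angles via the norm form -/

/-- The length of the chord cut out of the line at signed height `k * √3 / 2` by the circle of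
radius `d`. -/
noncomputable def lineChord (d k : ℝ) : ℝ := √(4 * d ^ 2 - 3 * k ^ 2)

theorem lineChord_neg (d k : ℝ) : lineChord d (-k) = lineChord d k := by
  rw [lineChord, lineChord, neg_sq]

theorem mul_sin_add_lineAngle {d k : ℝ} (hd : 0 < d) (h : 3 * k ^ 2 ≤ 4 * d ^ 2) :
    2 * d / √3 * Real.sin (Real.pi / 3 + lineAngle d k) = (lineChord d k + k) / 2 := by
  have hs := mul_sin_lineAngle hd h
  have hc := mul_cos_lineAngle hd k
  have e : 2 * d / √3 * Real.sin (Real.pi / 3 + lineAngle d k) =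
      (√3 * (2 * d / √3 * Real.cos (lineAngle d k)) + 2 * d / √3 * Real.sin (lineAngle d k)) / 2 := by
    rw [Real.sin_add, Real.sin_pi_div_three, Real.cos_pi_div_three]; ring
  rw [e, hs, hc, lineChord]
  field_simp

/-- Keeps `π/3 + lineAngle d k` within `π/2`, where the sine is increasing and angles can be
compared through their sines. -/
theorem lineAngle_le_pi_div_six {d k : ℝ} (hd : 0 < d) (h : k ≤ 0 ∨ 3 * k ^ 2 ≤ d ^ 2) :
    lineAngle d k ≤ Real.pi / 6 := by
  have hpi := Real.pi_pos
  rw [lineAngle, Real.arcsin_le_iff_le_sin' ⟨by linarith, by linarith⟩, Real.sin_pi_div_six,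
    div_le_div_iff₀ (by positivity) two_pos]
  have : k * √3 ≤ d := by
    rcases h with h | h
    · exact (mul_nonpos_of_nonpos_of_nonneg h (by positivity)).trans hd.le
    · refine le_of_abs_le (abs_le_of_sq_le_sq ?_ hd.le)
      rw [mul_pow, sqrt_three_sq]; linarith
  linarith

theorem pi_div_six_le_lineAngle {d k : ℝ} (hd : 0 < d) (hk : 0 ≤ k) (h : d ^ 2 ≤ 3 * k ^ 2) :
    Real.pi / 6 ≤ lineAngle d k := by
  have hpi := Real.pi_pos
  rw [lineAngle, Real.le_arcsin_iff_sin_le' ⟨by linarith, by linarith⟩, Real.sin_pi_div_six,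
    div_le_div_iff₀ two_pos (by positivity)]
  have : d ≤ k * √3 := by
    refine le_of_abs_le (abs_le_of_sq_le_sq ?_ (by positivity))
    rw [mul_pow, sqrt_three_sq]; linarith
  linarith

/-- The circle meets `b = k` at points with `a = (k ± lineChord d k) / 2`. The larger value is at
least `i` as soon as `2 * i - k ≤ lineChord d k`, and squaring turns this into the bound on the norm
form of `(i, k)`. -/
theorem sin_lineAngle_le {d i k : ℝ} (hd : 0 < d) (h : i ^ 2 - i * k + k ^ 2 ≤ d ^ 2) :
    Real.sin (lineAngle d i) ≤ Real.sin (Real.pi / 3 + lineAngle d k) := by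
  have hi : 3 * i ^ 2 ≤ 4 * d ^ 2 := by nlinarith [sq_nonneg (2 * k - i)]
  have hk : 3 * k ^ 2 ≤ 4 * d ^ 2 := by nlinarith [sq_nonneg (2 * i - k)]
  have : 0 < 2 * d / √3 := by positivity
  rw [← mul_le_mul_iff_of_pos_left this, mul_sin_lineAngle hd hi, mul_sin_add_lineAngle hd hk]
  have : 2 * i - k ≤ lineChord d k := Real.le_sqrt_of_sq_le (by linarith)
  linarith

theorem le_sin_lineAngle {d i k : ℝ} (hd : 0 < d) (hi : 3 * i ^ 2 ≤ 4 * d ^ 2)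
    (hk : 3 * k ^ 2 ≤ 4 * d ^ 2) (hki : k ≤ 2 * i) (h : d ^ 2 ≤ i ^ 2 - i * k + k ^ 2) :
    Real.sin (Real.pi / 3 + lineAngle d k) ≤ Real.sin (lineAngle d i) := by
  have : 0 < 2 * d / √3 := by positivity
  rw [← mul_le_mul_iff_of_pos_left this, mul_sin_lineAngle hd hi, mul_sin_add_lineAngle hd hk]
  have : lineChord d k ≤ 2 * i - k := Real.sqrt_le_iff.2 ⟨by linarith, by linarith⟩
  linarith

theorem lineAngle_le_add {d i k : ℝ} (hd : 0 < d) (h : i ^ 2 - i * k + k ^ 2 ≤ d ^ 2) :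
    lineAngle d i ≤ Real.pi / 3 + lineAngle d k := by
  by_contra! hc
  have := neg_le_lineAngle d k
  have := Real.pi_pos
  exact (Real.sin_lt_sin_of_lt_of_le_pi_div_two (by linarith) (lineAngle_le d i) hc).not_ge
    (sin_lineAngle_le hd h)

/-- Same comparison of sines as in `lineAngle_le_add`, read at the supplementary angle `2π/3 -
lineAngle d k`. -/
theorem lineAngle_add_le {d i k : ℝ} (hd : 0 < d) (h : i ^ 2 - i * k + k ^ 2 ≤ d ^ 2) :
    lineAngle d i + lineAngle d k ≤ 2 * Real.pi / 3 := by
  by_contra! hc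
  have := lineAngle_le d k
  have := Real.pi_pos
  have h2 := Real.sin_lt_sin_of_lt_of_le_pi_div_two (x := 2 * Real.pi / 3 - lineAngle d k)
    (by linarith) (lineAngle_le d i) (by linarith)
  rw [← Real.sin_pi_sub, show Real.pi - (2 * Real.pi / 3 - lineAngle d k)
    = Real.pi / 3 + lineAngle d k by ring] at h2
  exact h2.not_ge (sin_lineAngle_le hd h)

theorem add_le_lineAngle {d i k : ℝ} (hd : 0 < d) (hi : 0 ≤ i) (hi' : 3 * i ^ 2 ≤ 4 * d ^ 2)
    (hk : k ≤ 0 ∨ 3 * k ^ 2 ≤ d ^ 2) (hki : k ≤ 2 * i) (h : d ^ 2 ≤ i ^ 2 - i * k + k ^ 2) :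
    Real.pi / 3 + lineAngle d k ≤ lineAngle d i := by
  have h0 := lineAngle_nonneg hd hi
  have hpi := Real.pi_pos
  have h6 := lineAngle_le_pi_div_six hd hk
  rcases le_total (3 * k ^ 2) (4 * d ^ 2) with h' | h'
  · by_contra! hc
    exact (Real.sin_lt_sin_of_lt_of_le_pi_div_two (by linarith) (by linarith) hc).not_ge
      (le_sin_lineAngle hd hi' h' hki h)
  -- When `b = k` does not cross the circle, `k` must be nonpositive and its angle saturates at
  -- `-π/2`, so the left side is negative.
  · have hk0 : k ≤ 0 := hk.resolve_right (by nlinarith)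
    have h1 := lineAngle_of_le hd (neg_nonneg.2 hk0) (by linarith [neg_sq k])
    rw [lineAngle_neg] at h1
    linarith

theorem le_lineAngle_add {d i k : ℝ} (hd : 0 < d) (hi : 0 ≤ i) (hi' : 3 * i ^ 2 ≤ 4 * d ^ 2)
    (hk : 0 ≤ k) (hk' : 3 * k ^ 2 ≤ 4 * d ^ 2) (hdk : d ^ 2 ≤ 3 * k ^ 2) (hki : k ≤ 2 * i)
    (h : d ^ 2 ≤ i ^ 2 - i * k + k ^ 2) :
    2 * Real.pi / 3 ≤ lineAngle d i + lineAngle d k := by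
  have h0 := lineAngle_nonneg hd hi
  have hpi := Real.pi_pos
  have h6 := pi_div_six_le_lineAngle hd hk hdk
  by_contra! hc
  have h2 := Real.sin_lt_sin_of_lt_of_le_pi_div_two (y := 2 * Real.pi / 3 - lineAngle d k)
    (by linarith) (by linarith) (lt_sub_iff_add_lt.2 hc)
  rw [← Real.sin_pi_sub (_ - _), show Real.pi - (2 * Real.pi / 3 - lineAngle d k)
    = Real.pi / 3 + lineAngle d k by ring] at h2
  exact h2.not_ge (le_sin_lineAngle hd hi' hk' hki h)

/-! ### Closed forms of the moments by relative position of the two lines -/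

theorem arcMoment_left_eq {d i k : ℝ} (hd : 0 < d) (hi : 0 ≤ i)
    (h : i ^ 2 - i * k + k ^ 2 ≤ d ^ 2) :
    arcMoment d i k = (2 * d ^ 2 / 3 + k ^ 2) * (2 * Real.pi / 3 - lineAngle d k - lineAngle d i) / √3
      - k * lineChord d k / 2 + d ^ 2 / 6 - i ^ 2 / 4 - i * lineChord d i / 12
      - k * (lineChord d i / 3 - i) := by
  have hi' : 3 * i ^ 2 ≤ 4 * d ^ 2 := by nlinarith [sq_nonneg (2 * k - i)]
  have hk : 3 * k ^ 2 ≤ 4 * d ^ 2 := by nlinarith [sq_nonneg (2 * i - k)]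
  rw [arcMoment_left hd hi hk (lineAngle_le_add hd (by linarith)) (lineAngle_le_add hd h)
    (lineAngle_add_le hd h), arcPrimitive_pi_sub_lineAngle hd hk, arcPrimitive_add_lineAngle hd hi',
    lineChord, lineChord]
  ring

/-- The whole arc lies above `b = k`, so `lineAngle d k` does not occur in the value. For negative
`k` the line may therefore miss the circle altogether. -/
theorem arcMoment_full_eq {d i k : ℝ} (hd : 0 < d) (hi : 0 ≤ i) (hi' : 3 * i ^ 2 ≤ 4 * d ^ 2)
    (hk : k ≤ 0 ∨ 3 * k ^ 2 ≤ d ^ 2) (hki : k ≤ 2 * i) (h : d ^ 2 ≤ i ^ 2 - i * k + k ^ 2) :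
    arcMoment d i k = (2 * d ^ 2 / 3 + k ^ 2) * (Real.pi - 2 * lineAngle d i) / √3
      - i * lineChord d i / 6 - 2 * k * lineChord d i / 3 := by
  rw [arcMoment_full hd (hk.symm.imp_left fun h => by nlinarith)
    (add_le_lineAngle hd hi hi' hk hki h), arcPrimitive_add_lineAngle hd hi',
    arcPrimitive_sub_lineAngle hd hi', lineChord]
  ring

theorem arcMoment_inner_eq {d i k : ℝ} (hd : 0 < d) (hi : 0 ≤ i) (hi' : 3 * i ^ 2 ≤ d ^ 2)
    (hk : 0 ≤ k) (hk' : 3 * k ^ 2 ≤ 4 * d ^ 2) (hik : i ≤ 2 * k)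
    (h : d ^ 2 ≤ i ^ 2 - i * k + k ^ 2) :
    arcMoment d i k = (2 * d ^ 2 / 3 + k ^ 2) * (Real.pi - 2 * lineAngle d k) / √3
      - k * lineChord d k := by
  rw [arcMoment_inner hd hi hk' (add_le_lineAngle hd hk hk' (.inr hi') hik (by linarith)),
    arcPrimitive_pi_sub_lineAngle hd hk', arcPrimitive_lineAngle hd hk', lineChord]
  ring

theorem arcMoment_zero_of_le {d i k : ℝ} (hd : 0 < d) (hi : 0 ≤ i) (hk : 0 ≤ k)
    (hdk : d ^ 2 ≤ 3 * k ^ 2) (hki : k ≤ 2 * i) (h : d ^ 2 ≤ i ^ 2 - i * k + k ^ 2) :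
    arcMoment d i k = 0 := by
  rcases le_total (4 * d ^ 2) (3 * k ^ 2) with hk' | hk'
  · exact arcMoment_of_le_right hd hk hk'
  rcases le_total (4 * d ^ 2) (3 * i ^ 2) with hi' | hi'
  · exact arcMoment_of_le_left hd hi hi' k
  · exact arcMoment_eq_zero hd hi hk' (le_lineAngle_add hd hi hi' hk hk' hdk hki h)

/-! ### The arc sum and its seven explicit forms -/

/-- The angular average of the density of the difference of two points on the circle of
radius `d`, as a combination of arc moments. -/
noncomputable def arcSum (d : ℝ) : ℝ :=
  (arcMoment d 1 (-2) - 2 * arcMoment d 1 (-1) + arcMoment d 1 0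
    + arcMoment d 1 1 - 2 * arcMoment d 1 2 + arcMoment d 1 3) / 2
  - (Real.pi - 2 * lineAngle d 1) / √3
  - (arcMoment d 2 (-2) - arcMoment d 2 (-1) - arcMoment d 2 0 + 2 * arcMoment d 2 1
    - arcMoment d 2 2 - arcMoment d 2 3 + arcMoment d 2 4) / 2
  + 2 * (Real.pi - 2 * lineAngle d 2) / √3
  + (arcMoment d 3 (-1) - 2 * arcMoment d 3 0 + arcMoment d 3 1
    + arcMoment d 3 2 - 2 * arcMoment d 3 3 + arcMoment d 3 4) / 2
  - (Real.pi - 2 * lineAngle d 3) / √3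

theorem arcsin_sqrt_three_div_two_mul (d : ℝ) : Real.arcsin (√3 / (2 * d)) = lineAngle d 1 := by
  rw [lineAngle, one_mul]

theorem arcsin_sqrt_three_div (d : ℝ) : Real.arcsin (√3 / d) = lineAngle d 2 := by
  rw [lineAngle, mul_div_mul_left _ _ two_ne_zero]

theorem arcsin_three_mul_sqrt_three_div (d : ℝ) :
    Real.arcsin (3 * √3 / (2 * d)) = lineAngle d 3 := rfl

theorem arcsin_two_mul_sqrt_three_div (d : ℝ) : Real.arcsin (2 * √3 / d) = lineAngle d 4 := by
  rw [lineAngle, ← mul_div_mul_left _ _ (two_ne_zero (α := ℝ))]; congr 1; ring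

theorem sqrt_four_mul_sq_sub_three (d : ℝ) : √(4 * d ^ 2 - 3) = lineChord d 1 := by
  rw [lineChord]; norm_num

theorem sqrt_sq_sub_three (d : ℝ) : √(d ^ 2 - 3) = lineChord d 2 / 2 := by
  rw [lineChord, show 4 * d ^ 2 - 3 * 2 ^ 2 = 2 ^ 2 * (d ^ 2 - 3) by ring,
    Real.sqrt_mul (by norm_num), Real.sqrt_sq (by norm_num)]; ring

theorem sqrt_four_mul_sq_sub (d : ℝ) : √(4 * d ^ 2 - 27) = lineChord d 3 := by
  rw [lineChord]; norm_num

theorem sqrt_sq_sub_twelve (d : ℝ) : √(d ^ 2 - 12) = lineChord d 4 / 2 := by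
  rw [lineChord, show 4 * d ^ 2 - 3 * 4 ^ 2 = 2 ^ 2 * (d ^ 2 - 12) by ring,
    Real.sqrt_mul (by norm_num), Real.sqrt_sq (by norm_num)]; ring

/-- Needed because some pieces have coefficients that are multiples of `√3` while the moments
produce multiples of its inverse, and `ring` does not relate the two. -/
theorem sqrt_three_eq : √3 = 3 * (√3)⁻¹ := by
  field_simp; rw [sqrt_three_sq]

/-- In this and the next six lemmas, each pair `(i, k)` is sorted by its norm `i ^ 2 - i * k + k ^
2`: a norm at most `d ^ 2` gives the generic form `arcMoment_left_eq`, a larger one a full, inner or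
vanishing moment. -/
theorem arcSum_eq_pieceJE1 {d : ℝ} (hd : 0 < d) (h1 : 1 ≤ d ^ 2) (h2 : d ^ 2 ≤ 3) :
    arcSum d = pieceJE1 d := by
  -- The circle does not cross `a = 2` or `a = 3`: their moments vanish and their angles equal
  -- `π/2`.
  have z2 := arcMoment_of_le_left (i := 2) hd (by norm_num) (by linarith)
  have a2 := lineAngle_of_le (k := 2) hd (by norm_num) (by linarith)
  have z3 := arcMoment_of_le_left (i := 3) hd (by norm_num) (by linarith)
  have a3 := lineAngle_of_le (k := 3) hd (by norm_num) (by linarith)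
  rw [arcSum, arcMoment_full_eq (i := 1) (k := -2) hd (by norm_num) (by linarith) (.inl (by norm_num))
      (by norm_num) (by linarith),
    arcMoment_full_eq (i := 1) (k := -1) hd (by norm_num) (by linarith) (.inl (by norm_num))
      (by norm_num) (by linarith),
    arcMoment_left_eq (i := 1) (k := 0) hd (by norm_num) (by linarith),
    arcMoment_left_eq (i := 1) (k := 1) hd (by norm_num) (by linarith),
    arcMoment_zero_of_le (i := 1) (k := 2) hd (by norm_num) (by norm_num) (by linarith) (by norm_num) (by linarith),
    arcMoment_of_le_right (i := 1) (k := 3) hd (by norm_num) (by linarith),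
    pieceJE1]
  simp only [arcsin_sqrt_three_div_two_mul]
  simp only [lineAngle_zero, sqrt_four_mul_sq_sub_three, z2, a2, z3, a3]
  ring

theorem arcSum_eq_pieceJE2 {d : ℝ} (hd : 0 < d) (h1 : 3 ≤ d ^ 2) (h2 : d ^ 2 ≤ 4) :
    arcSum d = pieceJE2 d := by
  have z3 := arcMoment_of_le_left (i := 3) hd (by norm_num) (by linarith)
  have a3 := lineAngle_of_le (k := 3) hd (by norm_num) (by linarith)
  rw [arcSum, arcMoment_full_eq (i := 1) (k := -2) hd (by norm_num) (by linarith) (.inl (by norm_num))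
      (by norm_num) (by linarith),
    arcMoment_left_eq (i := 1) (k := -1) hd (by norm_num) (by linarith),
    arcMoment_left_eq (i := 1) (k := 0) hd (by norm_num) (by linarith),
    arcMoment_left_eq (i := 1) (k := 1) hd (by norm_num) (by linarith),
    arcMoment_left_eq (i := 1) (k := 2) hd (by norm_num) (by linarith),
    arcMoment_of_le_right (i := 1) (k := 3) hd (by norm_num) (by linarith),
    arcMoment_full_eq (i := 2) (k := -2) hd (by norm_num) (by linarith) (.inl (by norm_num))
      (by norm_num) (by linarith),
    arcMoment_full_eq (i := 2) (k := -1) hd (by norm_num) (by linarith) (.inl (by norm_num))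
      (by norm_num) (by linarith),
    arcMoment_full_eq (i := 2) (k := 0) hd (by norm_num) (by linarith) (.inl (by norm_num))
      (by norm_num) (by linarith),
    arcMoment_left_eq (i := 2) (k := 1) hd (by norm_num) (by linarith),
    arcMoment_zero_of_le (i := 2) (k := 2) hd (by norm_num) (by norm_num) (by linarith) (by norm_num) (by linarith),
    arcMoment_zero_of_le (i := 2) (k := 3) hd (by norm_num) (by norm_num) (by linarith) (by norm_num) (by linarith),
    arcMoment_zero_of_le (i := 2) (k := 4) hd (by norm_num) (by norm_num) (by linarith) (by norm_num) (by linarith),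
    pieceJE2]
  -- This rewriting has to come first, since `arcsin_sqrt_three_div` would also match `√3 / (2 *
  -- d)`, with `2 * d` as the radius.
  simp only [arcsin_sqrt_three_div_two_mul]
  simp only [lineAngle_neg, lineChord_neg, lineAngle_zero, arcsin_sqrt_three_div,
    sqrt_four_mul_sq_sub_three, sqrt_sq_sub_three, z3, a3]
  ring

theorem arcSum_eq_pieceJE3 {d : ℝ} (hd : 0 < d) (h1 : 4 ≤ d ^ 2) (h2 : d ^ 2 ≤ 27 / 4) :
    arcSum d = pieceJE3 d := by
  have z3 := arcMoment_of_le_left (i := 3) hd (by norm_num) (by linarith)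
  have a3 := lineAngle_of_le (k := 3) hd (by norm_num) (by linarith)
  rw [arcSum, arcMoment_full_eq (i := 1) (k := -2) hd (by norm_num) (by linarith) (.inl (by norm_num))
      (by norm_num) (by linarith),
    arcMoment_left_eq (i := 1) (k := -1) hd (by norm_num) (by linarith),
    arcMoment_left_eq (i := 1) (k := 0) hd (by norm_num) (by linarith),
    arcMoment_left_eq (i := 1) (k := 1) hd (by norm_num) (by linarith),
    arcMoment_left_eq (i := 1) (k := 2) hd (by norm_num) (by linarith),
    arcMoment_of_le_right (i := 1) (k := 3) hd (by norm_num) (by linarith),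
    arcMoment_full_eq (i := 2) (k := -2) hd (by norm_num) (by linarith) (.inl (by norm_num))
      (by norm_num) (by linarith),
    arcMoment_full_eq (i := 2) (k := -1) hd (by norm_num) (by linarith) (.inl (by norm_num))
      (by norm_num) (by linarith),
    arcMoment_left_eq (i := 2) (k := 0) hd (by norm_num) (by linarith),
    arcMoment_left_eq (i := 2) (k := 1) hd (by norm_num) (by linarith),
    arcMoment_left_eq (i := 2) (k := 2) hd (by norm_num) (by linarith),
    arcMoment_zero_of_le (i := 2) (k := 3) hd (by norm_num) (by norm_num) (by linarith) (by norm_num) (by linarith),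
    arcMoment_zero_of_le (i := 2) (k := 4) hd (by norm_num) (by norm_num) (by linarith) (by norm_num) (by linarith),
    pieceJE3]
  simp only [arcsin_sqrt_three_div_two_mul]
  simp only [lineAngle_neg, lineChord_neg, lineAngle_zero, arcsin_sqrt_three_div,
    sqrt_four_mul_sq_sub_three, sqrt_sq_sub_three, z3, a3]
  ring

theorem arcSum_eq_pieceJE4 {d : ℝ} (hd : 0 < d) (h1 : 27 / 4 ≤ d ^ 2) (h2 : d ^ 2 ≤ 7) :
    arcSum d = pieceJE4 d := by
  rw [arcSum, arcMoment_full_eq (i := 1) (k := -2) hd (by norm_num) (by linarith) (.inl (by norm_num))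
      (by norm_num) (by linarith),
    arcMoment_left_eq (i := 1) (k := -1) hd (by norm_num) (by linarith),
    arcMoment_left_eq (i := 1) (k := 0) hd (by norm_num) (by linarith),
    arcMoment_left_eq (i := 1) (k := 1) hd (by norm_num) (by linarith),
    arcMoment_left_eq (i := 1) (k := 2) hd (by norm_num) (by linarith),
    arcMoment_inner_eq (i := 1) (k := 3) hd (by norm_num) (by linarith) (by norm_num)
      (by linarith) (by norm_num) (by linarith),
    arcMoment_full_eq (i := 2) (k := -2) hd (by norm_num) (by linarith) (.inl (by norm_num))
      (by norm_num) (by linarith),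
    arcMoment_full_eq (i := 2) (k := -1) hd (by norm_num) (by linarith) (.inl (by norm_num))
      (by norm_num) (by linarith),
    arcMoment_left_eq (i := 2) (k := 0) hd (by norm_num) (by linarith),
    arcMoment_left_eq (i := 2) (k := 1) hd (by norm_num) (by linarith),
    arcMoment_left_eq (i := 2) (k := 2) hd (by norm_num) (by linarith),
    arcMoment_zero_of_le (i := 2) (k := 3) hd (by norm_num) (by norm_num) (by linarith) (by norm_num) (by linarith),
    arcMoment_zero_of_le (i := 2) (k := 4) hd (by norm_num) (by norm_num) (by linarith) (by norm_num) (by linarith),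
    arcMoment_full_eq (i := 3) (k := -1) hd (by norm_num) (by linarith) (.inl (by norm_num))
      (by norm_num) (by linarith),
    arcMoment_full_eq (i := 3) (k := 0) hd (by norm_num) (by linarith) (.inl (by norm_num))
      (by norm_num) (by linarith),
    arcMoment_full_eq (i := 3) (k := 1) hd (by norm_num) (by linarith) (.inr (by linarith))
      (by norm_num) (by linarith),
    arcMoment_zero_of_le (i := 3) (k := 2) hd (by norm_num) (by norm_num) (by linarith) (by norm_num) (by linarith),
    arcMoment_zero_of_le (i := 3) (k := 3) hd (by norm_num) (by norm_num) (by linarith) (by norm_num) (by linarith),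
    arcMoment_zero_of_le (i := 3) (k := 4) hd (by norm_num) (by norm_num) (by linarith) (by norm_num) (by linarith),
    pieceJE4]
  simp only [arcsin_sqrt_three_div_two_mul]
  simp only [lineAngle_neg, lineChord_neg, lineAngle_zero, arcsin_sqrt_three_div,
    arcsin_three_mul_sqrt_three_div, sqrt_four_mul_sq_sub_three, sqrt_sq_sub_three,
    sqrt_four_mul_sq_sub]
  linear_combination (3) * lineAngle d 3 * sqrt_three_eq

theorem arcSum_eq_pieceJE5 {d : ℝ} (hd : 0 < d) (h1 : 7 ≤ d ^ 2) (h2 : d ^ 2 ≤ 9) :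
    arcSum d = pieceJE5 d := by
  rw [arcSum, arcMoment_left_eq (i := 1) (k := -2) hd (by norm_num) (by linarith),
    arcMoment_left_eq (i := 1) (k := -1) hd (by norm_num) (by linarith),
    arcMoment_left_eq (i := 1) (k := 0) hd (by norm_num) (by linarith),
    arcMoment_left_eq (i := 1) (k := 1) hd (by norm_num) (by linarith),
    arcMoment_left_eq (i := 1) (k := 2) hd (by norm_num) (by linarith),
    arcMoment_left_eq (i := 1) (k := 3) hd (by norm_num) (by linarith),
    arcMoment_full_eq (i := 2) (k := -2) hd (by norm_num) (by linarith) (.inl (by norm_num))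
      (by norm_num) (by linarith),
    arcMoment_left_eq (i := 2) (k := -1) hd (by norm_num) (by linarith),
    arcMoment_left_eq (i := 2) (k := 0) hd (by norm_num) (by linarith),
    arcMoment_left_eq (i := 2) (k := 1) hd (by norm_num) (by linarith),
    arcMoment_left_eq (i := 2) (k := 2) hd (by norm_num) (by linarith),
    arcMoment_left_eq (i := 2) (k := 3) hd (by norm_num) (by linarith),
    arcMoment_zero_of_le (i := 2) (k := 4) hd (by norm_num) (by norm_num) (by linarith) (by norm_num) (by linarith),
    arcMoment_full_eq (i := 3) (k := -1) hd (by norm_num) (by linarith) (.inl (by norm_num))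
      (by norm_num) (by linarith),
    arcMoment_full_eq (i := 3) (k := 0) hd (by norm_num) (by linarith) (.inl (by norm_num))
      (by norm_num) (by linarith),
    arcMoment_left_eq (i := 3) (k := 1) hd (by norm_num) (by linarith),
    arcMoment_left_eq (i := 3) (k := 2) hd (by norm_num) (by linarith),
    arcMoment_zero_of_le (i := 3) (k := 3) hd (by norm_num) (by norm_num) (by linarith) (by norm_num) (by linarith),
    arcMoment_zero_of_le (i := 3) (k := 4) hd (by norm_num) (by norm_num) (by linarith) (by norm_num) (by linarith),
    pieceJE5]
  simp only [arcsin_sqrt_three_div_two_mul]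
  simp only [lineAngle_neg, lineChord_neg, lineAngle_zero, arcsin_sqrt_three_div,
    arcsin_three_mul_sqrt_three_div, sqrt_four_mul_sq_sub_three, sqrt_sq_sub_three,
    sqrt_four_mul_sq_sub]
  linear_combination (7 / 2) * lineAngle d 3 * sqrt_three_eq

theorem arcSum_eq_pieceJE6 {d : ℝ} (hd : 0 < d) (h1 : 9 ≤ d ^ 2) (h2 : d ^ 2 ≤ 12) :
    arcSum d = pieceJE6 d := by
  rw [arcSum, arcMoment_left_eq (i := 1) (k := -2) hd (by norm_num) (by linarith),
    arcMoment_left_eq (i := 1) (k := -1) hd (by norm_num) (by linarith),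
    arcMoment_left_eq (i := 1) (k := 0) hd (by norm_num) (by linarith),
    arcMoment_left_eq (i := 1) (k := 1) hd (by norm_num) (by linarith),
    arcMoment_left_eq (i := 1) (k := 2) hd (by norm_num) (by linarith),
    arcMoment_left_eq (i := 1) (k := 3) hd (by norm_num) (by linarith),
    arcMoment_full_eq (i := 2) (k := -2) hd (by norm_num) (by linarith) (.inl (by norm_num))
      (by norm_num) (by linarith),
    arcMoment_left_eq (i := 2) (k := -1) hd (by norm_num) (by linarith),
    arcMoment_left_eq (i := 2) (k := 0) hd (by norm_num) (by linarith),
    arcMoment_left_eq (i := 2) (k := 1) hd (by norm_num) (by linarith),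
    arcMoment_left_eq (i := 2) (k := 2) hd (by norm_num) (by linarith),
    arcMoment_left_eq (i := 2) (k := 3) hd (by norm_num) (by linarith),
    arcMoment_zero_of_le (i := 2) (k := 4) hd (by norm_num) (by norm_num) (by linarith) (by norm_num) (by linarith),
    arcMoment_full_eq (i := 3) (k := -1) hd (by norm_num) (by linarith) (.inl (by norm_num))
      (by norm_num) (by linarith),
    arcMoment_left_eq (i := 3) (k := 0) hd (by norm_num) (by linarith),
    arcMoment_left_eq (i := 3) (k := 1) hd (by norm_num) (by linarith),
    arcMoment_left_eq (i := 3) (k := 2) hd (by norm_num) (by linarith),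
    arcMoment_left_eq (i := 3) (k := 3) hd (by norm_num) (by linarith),
    arcMoment_zero_of_le (i := 3) (k := 4) hd (by norm_num) (by norm_num) (by linarith) (by norm_num) (by linarith),
    pieceJE6]
  simp only [arcsin_sqrt_three_div_two_mul]
  simp only [lineAngle_neg, lineChord_neg, lineAngle_zero, arcsin_sqrt_three_div,
    arcsin_three_mul_sqrt_three_div, sqrt_four_mul_sq_sub_three, sqrt_sq_sub_three,
    sqrt_four_mul_sq_sub]
  linear_combination (-(5 / 2)) * lineAngle d 3 * sqrt_three_eq

theorem arcSum_eq_pieceJE7 {d : ℝ} (hd : 0 < d) (h1 : 12 ≤ d ^ 2) (h2 : d ^ 2 ≤ 13) :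
    arcSum d = pieceJE7 d := by
  rw [arcSum, arcMoment_left_eq (i := 1) (k := -2) hd (by norm_num) (by linarith),
    arcMoment_left_eq (i := 1) (k := -1) hd (by norm_num) (by linarith),
    arcMoment_left_eq (i := 1) (k := 0) hd (by norm_num) (by linarith),
    arcMoment_left_eq (i := 1) (k := 1) hd (by norm_num) (by linarith),
    arcMoment_left_eq (i := 1) (k := 2) hd (by norm_num) (by linarith),
    arcMoment_left_eq (i := 1) (k := 3) hd (by norm_num) (by linarith),
    arcMoment_left_eq (i := 2) (k := -2) hd (by norm_num) (by linarith),
    arcMoment_left_eq (i := 2) (k := -1) hd (by norm_num) (by linarith),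
    arcMoment_left_eq (i := 2) (k := 0) hd (by norm_num) (by linarith),
    arcMoment_left_eq (i := 2) (k := 1) hd (by norm_num) (by linarith),
    arcMoment_left_eq (i := 2) (k := 2) hd (by norm_num) (by linarith),
    arcMoment_left_eq (i := 2) (k := 3) hd (by norm_num) (by linarith),
    arcMoment_left_eq (i := 2) (k := 4) hd (by norm_num) (by linarith),
    arcMoment_full_eq (i := 3) (k := -1) hd (by norm_num) (by linarith) (.inl (by norm_num))
      (by norm_num) (by linarith),
    arcMoment_left_eq (i := 3) (k := 0) hd (by norm_num) (by linarith),
    arcMoment_left_eq (i := 3) (k := 1) hd (by norm_num) (by linarith),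
    arcMoment_left_eq (i := 3) (k := 2) hd (by norm_num) (by linarith),
    arcMoment_left_eq (i := 3) (k := 3) hd (by norm_num) (by linarith),
    arcMoment_zero_of_le (i := 3) (k := 4) hd (by norm_num) (by norm_num) (by linarith) (by norm_num) (by linarith),
    pieceJE7]
  simp only [arcsin_sqrt_three_div_two_mul]
  simp only [lineAngle_neg, lineChord_neg, lineAngle_zero, arcsin_three_mul_sqrt_three_div,
    arcsin_two_mul_sqrt_three_div, sqrt_four_mul_sq_sub_three, sqrt_four_mul_sq_sub,
    sqrt_sq_sub_twelve]
  linear_combination (-(5 / 2)) * lineAngle d 3 * sqrt_three_eq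

/-! ### Density of the difference in oblique coordinates -/

/-- The density of the difference of two independent uniform points of `[0, 1]`. -/
noncomputable def hat (x : ℝ) : ℝ := max (min (1 + x) (1 - x)) 0

/-- The distribution function of `hat`. -/
noncomputable def hatPrimitive (x : ℝ) : ℝ :=
  ((max (x + 1) 0) ^ 2 - 2 * (max x 0) ^ 2 + (max (x - 1) 0) ^ 2) / 2

/-- The projection of the line onto the unit interval. -/
noncomputable def unitClamp (x : ℝ) : ℝ := max 0 (min 1 x)

/-- The density of the coordinates of the difference of the two points in the basis
`edge2, edge0`. -/
noncomputable def diffDensity (a b : ℝ) : ℝ :=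
  hatPrimitive (b + 1 - unitClamp (a - 2)) - hatPrimitive (b + 1 - unitClamp (a - 1))

theorem continuous_hat : Continuous hat := by unfold hat; fun_prop

theorem continuous_hatPrimitive : Continuous hatPrimitive := by unfold hatPrimitive; fun_prop

theorem continuous_diffDensity : Continuous (fun p : ℝ × ℝ => diffDensity p.1 p.2) := by
  unfold diffDensity hatPrimitive unitClamp; fun_prop

theorem hat_nonneg (x : ℝ) : 0 ≤ hat x := le_max_right _ _

theorem hasDerivAt_sq_max (x : ℝ) : HasDerivAt (fun y : ℝ => (max y 0) ^ 2) (2 * max x 0) x := by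
  rcases lt_trichotomy x 0 with h | rfl | h
  · rw [max_eq_right h.le, mul_zero]
    refine (hasDerivAt_const x (0 : ℝ)).congr_of_eventuallyEq ?_
    filter_upwards [Iio_mem_nhds h] with y hy
    simp [max_eq_right (le_of_lt (mem_Iio.1 hy))]
  -- At the kink the function is bounded by `y ^ 2`, hence is `o(y)`.
  · rw [hasDerivAt_iff_isLittleO_nhds_zero]
    have h2 : (fun h : ℝ => h ^ 2) =o[nhds 0] (fun h => h) := by
      simpa using Asymptotics.isLittleO_pow_pow (𝕜 := ℝ) (one_lt_two)
    refine (Asymptotics.IsBigO.of_bound 1 (Filter.Eventually.of_forall fun y => ?_)).trans_isLittleO h2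
    rcases le_total y 0 with hy | hy <;> simp [hy, sq_nonneg]
  · rw [max_eq_left h.le]
    have := hasDerivAt_pow 2 x
    refine (this.congr_deriv (by simp)).congr_of_eventuallyEq ?_
    filter_upwards [Ioi_mem_nhds h] with y hy
    simp [max_eq_left (le_of_lt (mem_Ioi.1 hy))]

theorem hat_eq (x : ℝ) : hat x = max (x + 1) 0 - 2 * max x 0 + max (x - 1) 0 := by
  unfold hat
  rcases le_total (x + 1) 0 with h1 | h1
  · rw [min_eq_left (by linarith), max_eq_right (by linarith), max_eq_right h1,
      max_eq_right (by linarith), max_eq_right (by linarith)]; ring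
  rcases le_total x 0 with h2 | h2
  · rw [min_eq_left (by linarith), max_eq_left (by linarith), max_eq_left h1, max_eq_right h2,
      max_eq_right (by linarith)]; ring
  rcases le_total (x - 1) 0 with h3 | h3
  · rw [min_eq_right (by linarith), max_eq_left (by linarith), max_eq_left h1, max_eq_left h2,
      max_eq_right h3]; ring
  · rw [min_eq_right (by linarith), max_eq_right (by linarith), max_eq_left h1, max_eq_left h2,
      max_eq_left h3]; ring

theorem hasDerivAt_hatPrimitive (x : ℝ) : HasDerivAt hatPrimitive (hat x) x := by
  have h1 := (hasDerivAt_sq_max (x + 1)).comp_add_const x 1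
  have h2 := (hasDerivAt_sq_max x).const_mul 2
  have h3 := (hasDerivAt_sq_max (x - 1)).comp_sub_const x 1
  refine (((h1.sub h2).add h3).div_const 2).congr_deriv ?_
  rw [hat_eq]; ring

theorem integral_hat_sub (b p q : ℝ) :
    ∫ t in p..q, hat (b - t) = hatPrimitive (b - p) - hatPrimitive (b - q) := by
  rw [intervalIntegral.integral_comp_sub_left hat,
    intervalIntegral.integral_eq_sub_of_hasDerivAt (fun x _ => hasDerivAt_hatPrimitive x)
      (continuous_hat.intervalIntegrable _ _)]

theorem monotone_hatPrimitive : Monotone hatPrimitive :=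
  monotone_of_hasDerivAt_nonneg hasDerivAt_hatPrimitive hat_nonneg

theorem monotone_unitClamp : Monotone unitClamp := fun x y h => by
  unfold unitClamp; gcongr

theorem diffDensity_nonneg (a b : ℝ) : 0 ≤ diffDensity a b := by
  have : unitClamp (a - 2) ≤ unitClamp (a - 1) := monotone_unitClamp (by linarith)
  exact sub_nonneg.2 (monotone_hatPrimitive (by linarith))

/-- `hat` is even with total mass one. This is what lets `hatPrimitive (m - x)` be traded for
`hatPrimitive (x - m)` after the reflection. -/
theorem hatPrimitive_neg (x : ℝ) : hatPrimitive (-x) = 1 - hatPrimitive x := by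
  have h (y : ℝ) : (max (-y) 0) ^ 2 = y ^ 2 - (max y 0) ^ 2 := by
    rcases le_total y 0 with hy | hy <;> simp [hy]
  have h1 := h (x - 1)
  have h2 := h x
  have h3 := h (x + 1)
  rw [neg_sub', sub_neg_eq_add] at h1
  rw [neg_add'] at h3
  unfold hatPrimitive
  rw [h1, h2, h3]; ring

theorem hatPrimitive_of_le {x : ℝ} (h : x ≤ -1) : hatPrimitive x = 0 := by
  unfold hatPrimitive
  rw [max_eq_right (by linarith), max_eq_right (by linarith), max_eq_right (by linarith)]; norm_num

theorem hatPrimitive_of_ge {x : ℝ} (h : 1 ≤ x) : hatPrimitive x = 1 := by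
  have := hatPrimitive_neg x
  rw [hatPrimitive_of_le (by linarith)] at this
  linarith

theorem unitClamp_of_nonpos {x : ℝ} (h : x ≤ 0) : unitClamp x = 0 := by
  unfold unitClamp; rw [min_eq_right (by linarith), max_eq_left h]

theorem unitClamp_of_mem {x : ℝ} (h0 : 0 ≤ x) (h1 : x ≤ 1) : unitClamp x = x := by
  unfold unitClamp; rw [min_eq_right h1, max_eq_right h0]

theorem unitClamp_of_one_le {x : ℝ} (h : 1 ≤ x) : unitClamp x = 1 := by
  unfold unitClamp; rw [min_eq_left h, max_eq_right zero_le_one]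

/-- The support lies in a polygon whose norm form runs from 1 to 13. The bound on `a` discards the
lower half of the circle, the other two give the range of distances. -/
theorem diffDensity_support {a b : ℝ} (h : diffDensity a b ≠ 0) :
    1 < a ∧ 1 ≤ a ^ 2 - a * b + b ^ 2 ∧ a ^ 2 - a * b + b ^ 2 ≤ 13 := by
  rw [diffDensity] at h
  rcases le_or_gt a 1 with h1 | h1
  · rw [unitClamp_of_nonpos (by linarith), unitClamp_of_nonpos (by linarith), sub_self] at h
    exact (h rfl).elim
  refine ⟨h1, ?_⟩
  rcases le_total a 2 with h2 | h2
  · rw [unitClamp_of_nonpos (by linarith), unitClamp_of_mem (by linarith) (by linarith)] at h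
    have hb : -2 < b := by
      by_contra! hb
      exact h (by rw [hatPrimitive_of_le (by linarith), hatPrimitive_of_le (by linarith), sub_self])
    have hb' : b < a - 1 := by
      by_contra! hb
      exact h (by rw [hatPrimitive_of_ge (by linarith), hatPrimitive_of_ge (by linarith), sub_self])
    constructor <;> nlinarith
  rcases le_total a 3 with h3 | h3
  · rw [unitClamp_of_one_le (x := a - 1) (by linarith),
      unitClamp_of_mem (by linarith) (by linarith)] at h
    have hb : a - 4 < b := by
      by_contra! hb
      exact h (by rw [hatPrimitive_of_le (by linarith), hatPrimitive_of_le (by linarith), sub_self])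
    have hb' : b < 1 := by
      by_contra! hb
      exact h (by rw [hatPrimitive_of_ge (by linarith), hatPrimitive_of_ge (by linarith), sub_self])
    constructor <;> nlinarith [sq_nonneg (2 * b - a)]
  · rw [unitClamp_of_one_le (by linarith), unitClamp_of_one_le (by linarith), sub_self] at h
    exact (h rfl).elim

/-- The clamps change regime at `a = 1, 2, 3`; each indicator carries the jump from one regime's
formula to the next. No term mixes `b` with `a - b`, which the reflection argument requires. -/
theorem diffDensity_eq_indicator (a b : ℝ) :
    diffDensity a b
      = (Ioi 1).indicator (fun _ => hatPrimitive (b + 1) - hatPrimitive (2 - (a - b))) a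
      + (Ioi 2).indicator (fun _ => hatPrimitive (2 - (a - b)) + hatPrimitive (3 - (a - b))
          - hatPrimitive (b + 1) - hatPrimitive b) a
      + (Ioi 3).indicator (fun _ => hatPrimitive b - hatPrimitive (3 - (a - b))) a := by
  have e2 : 2 - (a - b) = b + 1 - (a - 1) := by ring
  have e3 : 3 - (a - b) = b + 1 - (a - 2) := by ring
  rw [diffDensity, e2, e3]
  simp only [indicator_apply, mem_Ioi]
  rcases le_or_gt a 1 with h1 | h1
  · rw [if_neg (by linarith), if_neg (by linarith), if_neg (by linarith),
      unitClamp_of_nonpos (by linarith), unitClamp_of_nonpos (by linarith)]; ring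
  rcases le_or_gt a 2 with h2 | h2
  · rw [if_pos h1, if_neg (by linarith), if_neg (by linarith),
      unitClamp_of_nonpos (by linarith), unitClamp_of_mem (by linarith) (by linarith), sub_zero]; ring
  rcases le_or_gt a 3 with h3 | h3
  · rw [if_pos h1, if_pos h2, if_neg (by linarith),
      unitClamp_of_mem (by linarith) (by linarith), unitClamp_of_one_le (by linarith),
      add_sub_cancel_right]; ring
  · rw [if_pos h1, if_pos h2, if_pos h3,
      unitClamp_of_one_le (by linarith), unitClamp_of_one_le (by linarith)]; ring

/-! ### The integral of the density over a circle -/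

theorem Ioc_inter_lt_mul_sin {d i : ℝ} (hd : 0 < d) (hi : 0 ≤ i) :
    Ioc 0 Real.pi ∩ {φ | i < 2 * d / √3 * Real.sin φ}
      = Ioo (lineAngle d i) (Real.pi - lineAngle d i) := by
  have h0 := lineAngle_nonneg hd hi
  have hp := Real.pi_pos
  rcases le_total (4 * d ^ 2) (3 * i ^ 2) with h | h
  · rw [lineAngle_of_le hd hi h, sub_half, Ioo_self]
    refine eq_empty_of_forall_notMem fun φ hφ => (mem_ofPred.1 hφ.2).not_ge ?_
    refine le_trans ?_ (two_mul_div_sqrt_three_le hi h)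
    exact mul_le_of_le_one_right (by positivity) (Real.sin_le_one φ)
  have hR : 0 < 2 * d / √3 := by positivity
  ext φ
  simp only [mem_inter_iff, mem_Ioc, mem_ofPred_eq, mem_Ioo]
  constructor
  · rintro ⟨⟨h1, h2⟩, h3⟩
    constructor
    · by_contra! hc
      exact h3.not_ge (mul_sin_le_of_le_lineAngle hd h (by linarith) hc)
    · by_contra! hc
      exact h3.not_ge (mul_sin_le_of_lineAngle_le hd h (by linarith) hc)
  · rintro ⟨h1, h2⟩
    refine ⟨⟨by linarith, by linarith⟩, ?_⟩
    conv_lhs => rw [← mul_sin_lineAngle hd h]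
    rw [mul_lt_mul_iff_of_pos_left hR]
    rcases le_total φ (Real.pi / 2) with h' | h'
    · exact Real.sin_lt_sin_of_lt_of_le_pi_div_two (by linarith) h' h1
    · rw [← Real.sin_pi_sub φ]
      exact Real.sin_lt_sin_of_lt_of_le_pi_div_two (by linarith) (by linarith) (by linarith)

theorem indicator_Ioi_mul_sin (d i : ℝ) (f : ℝ → ℝ) :
    (fun φ => (Ioi i).indicator (fun _ => f φ) (2 * d / √3 * Real.sin φ))
      = {φ | i < 2 * d / √3 * Real.sin φ}.indicator f := rfl

theorem measurableSet_lt_mul_sin (d i : ℝ) :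
    MeasurableSet {φ | i < 2 * d / √3 * Real.sin φ} :=
  measurableSet_lt (by fun_prop) (by fun_prop)

theorem integral_indicator_mul_sin {d i : ℝ} (hd : 0 < d) (hi : 0 ≤ i) (f : ℝ → ℝ) :
    ∫ φ in 0..Real.pi, (Ioi i).indicator (fun _ => f φ) (2 * d / √3 * Real.sin φ)
      = ∫ φ in lineAngle d i..Real.pi - lineAngle d i, f φ := by
  have := lineAngle_le d i
  rw [indicator_Ioi_mul_sin, intervalIntegral.integral_of_le Real.pi_pos.le,
    setIntegral_indicator (measurableSet_lt_mul_sin d i), Ioc_inter_lt_mul_sin hd hi,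
    intervalIntegral.integral_of_le (by linarith), integral_Ioc_eq_integral_Ioo]

theorem intervalIntegrable_indicator_mul_sin (d i : ℝ) {f : ℝ → ℝ} (hf : Continuous f) (p q : ℝ) :
    IntervalIntegrable (fun φ => (Ioi i).indicator (fun _ => f φ) (2 * d / √3 * Real.sin φ))
      volume p q := by
  rw [indicator_Ioi_mul_sin]
  have := hf.intervalIntegrable (μ := volume) p q
  exact ⟨this.1.indicator (measurableSet_lt_mul_sin d i),
    this.2.indicator (measurableSet_lt_mul_sin d i)⟩

/-- The arc is symmetric about `π/2`, and `φ ↦ π - φ` turns `a - b`, which is `2d/√3 · sin (φ -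
π/3)`, into `b`. -/
theorem integral_reflect (d i : ℝ) (f : ℝ → ℝ) :
    ∫ φ in lineAngle d i..Real.pi - lineAngle d i,
      f (2 * d / √3 * Real.sin φ - 2 * d / √3 * Real.sin (φ + Real.pi / 3))
      = ∫ φ in lineAngle d i..Real.pi - lineAngle d i,
        f (2 * d / √3 * Real.sin (φ + Real.pi / 3)) := by
  have h := intervalIntegral.integral_comp_sub_left (a := lineAngle d i)
    (b := Real.pi - lineAngle d i) (fun φ => f (2 * d / √3 * Real.sin (φ + Real.pi / 3))) Real.pi
  rw [sub_sub_cancel] at h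
  rw [← h]
  congr 1; ext φ; congr 1
  rw [show Real.pi - φ + Real.pi / 3 = Real.pi - (φ - Real.pi / 3) by ring, Real.sin_pi_sub,
    Real.sin_add, Real.sin_sub, Real.sin_pi_div_three, Real.cos_pi_div_three]
  ring

theorem integral_hatPrimitive_sub (d i m : ℝ) :
    ∫ φ in lineAngle d i..Real.pi - lineAngle d i,
      hatPrimitive (2 * d / √3 * Real.sin (φ + Real.pi / 3) - m)
      = √3 * (arcMoment d i (m - 1) - 2 * arcMoment d i m + arcMoment d i (m + 1)) / 2 := by
  have hI (k : ℝ) : IntervalIntegrable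
      (fun φ => (max (2 * d / √3 * Real.sin (φ + Real.pi / 3) - k) 0) ^ 2) volume
      (lineAngle d i) (Real.pi - lineAngle d i) := by
    apply Continuous.intervalIntegrable; fun_prop
  have hM (k : ℝ) : √3 * arcMoment d i k = ∫ φ in lineAngle d i..Real.pi - lineAngle d i,
      (max (2 * d / √3 * Real.sin (φ + Real.pi / 3) - k) 0) ^ 2 := by
    rw [arcMoment, mul_div_cancel₀ _ (by positivity)]
  rw [mul_add, mul_sub, mul_left_comm, hM, hM, hM, ← intervalIntegral.integral_const_mul,
    ← intervalIntegral.integral_sub (hI _) ((hI _).const_mul 2),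
    ← intervalIntegral.integral_add ((hI _).sub ((hI _).const_mul 2)) (hI _),
    ← intervalIntegral.integral_div]
  congr 1; ext φ
  generalize 2 * d / √3 * Real.sin (φ + Real.pi / 3) = x
  rw [hatPrimitive, show x - m + 1 = x - (m - 1) by ring, show x - m - 1 = x - (m + 1) by ring]

theorem integral_hatPrimitive_reflect (d i m : ℝ) :
    ∫ φ in lineAngle d i..Real.pi - lineAngle d i,
      hatPrimitive (m - (2 * d / √3 * Real.sin φ - 2 * d / √3 * Real.sin (φ + Real.pi / 3)))
      = Real.pi - 2 * lineAngle d i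
        - √3 * (arcMoment d i (m - 1) - 2 * arcMoment d i m + arcMoment d i (m + 1)) / 2 := by
  rw [integral_reflect d i (fun x => hatPrimitive (m - x)), ← integral_hatPrimitive_sub]
  have (φ : ℝ) : hatPrimitive (m - 2 * d / √3 * Real.sin (φ + Real.pi / 3))
      = 1 - hatPrimitive (2 * d / √3 * Real.sin (φ + Real.pi / 3) - m) := by
    rw [← hatPrimitive_neg, neg_sub]
  simp only [this]
  have hc : Continuous fun φ => hatPrimitive (2 * d / √3 * Real.sin (φ + Real.pi / 3) - m) :=
    continuous_hatPrimitive.comp (by fun_prop)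
  rw [intervalIntegral.integral_sub (by simp) (hc.intervalIntegrable _ _),
    intervalIntegral.integral_const]
  simp; ring

theorem integral_indicator_add_add {d : ℝ} (hd : 0 < d) {f g h : ℝ → ℝ} (hf : Continuous f)
    (hg : Continuous g) (hh : Continuous h) :
    ∫ φ in 0..Real.pi, ((Ioi 1).indicator (fun _ => f φ) (2 * d / √3 * Real.sin φ)
      + (Ioi 2).indicator (fun _ => g φ) (2 * d / √3 * Real.sin φ)
      + (Ioi 3).indicator (fun _ => h φ) (2 * d / √3 * Real.sin φ))
      = (∫ φ in lineAngle d 1..Real.pi - lineAngle d 1, f φ)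
        + (∫ φ in lineAngle d 2..Real.pi - lineAngle d 2, g φ)
        + (∫ φ in lineAngle d 3..Real.pi - lineAngle d 3, h φ) := by
  have i1 := intervalIntegrable_indicator_mul_sin d 1 hf 0 Real.pi
  have i2 := intervalIntegrable_indicator_mul_sin d 2 hg 0 Real.pi
  have i3 := intervalIntegrable_indicator_mul_sin d 3 hh 0 Real.pi
  rw [intervalIntegral.integral_add (i1.add i2) i3, intervalIntegral.integral_add i1 i2,
    integral_indicator_mul_sin hd (by norm_num), integral_indicator_mul_sin hd (by norm_num),
    integral_indicator_mul_sin hd (by norm_num)]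

theorem integral_sub_of_continuous {f g : ℝ → ℝ} (hf : Continuous f) (hg : Continuous g)
    (p q : ℝ) : ∫ φ in p..q, (f φ - g φ) = (∫ φ in p..q, f φ) - ∫ φ in p..q, g φ :=
  intervalIntegral.integral_sub (hf.intervalIntegrable _ _) (hg.intervalIntegrable _ _)

theorem integral_add_of_continuous {f g : ℝ → ℝ} (hf : Continuous f) (hg : Continuous g)
    (p q : ℝ) : ∫ φ in p..q, (f φ + g φ) = (∫ φ in p..q, f φ) + ∫ φ in p..q, g φ :=
  intervalIntegral.integral_add (hf.intervalIntegrable _ _) (hg.intervalIntegrable _ _)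

theorem integral_diffDensity {d : ℝ} (hd : 0 < d) :
    ∫ φ in 0..Real.pi, diffDensity (2 * d / √3 * Real.sin φ)
      (2 * d / √3 * Real.sin (φ + Real.pi / 3)) = √3 * arcSum d := by
  have c1 (m : ℝ) : Continuous fun φ => hatPrimitive
      (m - (2 * d / √3 * Real.sin φ - 2 * d / √3 * Real.sin (φ + Real.pi / 3))) :=
    continuous_hatPrimitive.comp (by fun_prop)
  have c2 (m : ℝ) : Continuous fun φ => hatPrimitive
      (2 * d / √3 * Real.sin (φ + Real.pi / 3) - m) :=
    continuous_hatPrimitive.comp (by fun_prop)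
  have e1 (b : ℝ) : b + 1 = b - (-1) := by ring
  have e0 (φ : ℝ) : hatPrimitive (2 * d / √3 * Real.sin (φ + Real.pi / 3))
    = hatPrimitive (2 * d / √3 * Real.sin (φ + Real.pi / 3) - 0) := by rw [sub_zero]
  simp only [diffDensity_eq_indicator]
  simp only [e1, e0]
  refine (integral_indicator_add_add hd ((c2 (-1)).fun_sub (c1 2))
    ((((c1 2).fun_add (c1 3)).fun_sub (c2 (-1))).fun_sub (c2 0)) ((c2 0).fun_sub (c1 3))).trans ?_
  rw [integral_sub_of_continuous (c2 (-1)) (c1 2),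
    integral_sub_of_continuous (((c1 2).fun_add (c1 3)).fun_sub (c2 (-1))) (c2 0),
    integral_sub_of_continuous ((c1 2).fun_add (c1 3)) (c2 (-1)),
    integral_add_of_continuous (c1 2) (c1 3), integral_sub_of_continuous (c2 0) (c1 3)]
  simp only [integral_hatPrimitive_sub, integral_hatPrimitive_reflect]
  rw [arcSum]
  norm_num
  field_simp
  ring

/-- Nonnegativity is read off from the integral, with no estimate of the explicit pieces. -/
theorem arcSum_nonneg {d : ℝ} (hd : 0 < d) : 0 ≤ arcSum d := by
  refine nonneg_of_mul_nonneg_right (a := √3) ?_ (by positivity)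
  rw [← integral_diffDensity hd]
  exact intervalIntegral.integral_nonneg Real.pi_pos.le fun φ _ => diffDensity_nonneg _ _

/-- Confirms that `d ^ 2` is the norm form of the coordinates on the circle, so
`diffDensity_support` translates into bounds on `d`. -/
theorem mul_sin_form (d φ : ℝ) :
    (2 * d / √3 * Real.sin φ) ^ 2
      - 2 * d / √3 * Real.sin φ * (2 * d / √3 * Real.sin (φ + Real.pi / 3))
      + (2 * d / √3 * Real.sin (φ + Real.pi / 3)) ^ 2 = d ^ 2 := by
  have h3 := sqrt_three_sq
  rw [Real.sin_add, Real.sin_pi_div_three, Real.cos_pi_div_three]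
  field_simp
  linear_combination (3 * d ^ 2) * Real.sin_sq_add_cos_sq φ
    + (d ^ 2 * Real.cos φ ^ 2 - d ^ 2) * h3

theorem arcSum_eq_zero {d : ℝ} (hd : 0 < d) (h : d ^ 2 < 1 ∨ 13 < d ^ 2) : arcSum d = 0 := by
  have hz (φ : ℝ) : diffDensity (2 * d / √3 * Real.sin φ)
      (2 * d / √3 * Real.sin (φ + Real.pi / 3)) = 0 := by
    by_contra hne
    have := (diffDensity_support hne).2
    rw [mul_sin_form] at this
    rcases h with h | h <;> linarith [this.1, this.2]
  have := integral_diffDensity hd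
  simp only [hz, intervalIntegral.integral_zero] at this
  exact (mul_eq_zero.1 this.symm).resolve_left (by positivity)

/-! ### The piecewise density as a multiple of the arc sum -/

theorem three_mul_sqrt_three_div_two_sq : (3 * √3 / 2) ^ 2 = (27 / 4 : ℝ) := by
  linear_combination 9 / 4 * sqrt_three_sq

theorem two_mul_sqrt_three_sq : (2 * √3) ^ 2 = (12 : ℝ) := by
  linear_combination 4 * sqrt_three_sq

theorem sq_le_of_le {d x y : ℝ} (hd : 0 < d) (hx : x ^ 2 = y) (h : d ≤ x) : d ^ 2 ≤ y := by
  rw [← hx]; gcongr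

theorem le_sq_of_le {d x y : ℝ} (hx0 : 0 ≤ x) (hx : x ^ 2 = y) (h : x ≤ d) : y ≤ d ^ 2 := by
  rw [← hx]; gcongr

/-- The intervals are closed on purpose: at a common end point both neighbouring pieces equal
`arcSum`, hence each other. -/
theorem arcSum_of_mem_Icc1 {d : ℝ} (h : d ∈ Icc 1 √3) : arcSum d = pieceJE1 d :=
  have hd : 0 < d := one_pos.trans_le h.1
  arcSum_eq_pieceJE1 hd (le_sq_of_le one_pos.le (one_pow 2) h.1) (sq_le_of_le hd sqrt_three_sq h.2)

theorem arcSum_of_mem_Icc2 {d : ℝ} (h : d ∈ Icc √3 2) : arcSum d = pieceJE2 d :=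
  have hd : 0 < d := (by positivity : 0 < √3).trans_le h.1
  arcSum_eq_pieceJE2 hd (le_sq_of_le (by positivity) sqrt_three_sq h.1)
    (sq_le_of_le hd (by norm_num) h.2)

theorem arcSum_of_mem_Icc3 {d : ℝ} (h : d ∈ Icc 2 (3 * √3 / 2)) : arcSum d = pieceJE3 d :=
  have hd : 0 < d := two_pos.trans_le h.1
  arcSum_eq_pieceJE3 hd (le_sq_of_le two_pos.le (by norm_num) h.1)
    (sq_le_of_le hd three_mul_sqrt_three_div_two_sq h.2)

theorem arcSum_of_mem_Icc4 {d : ℝ} (h : d ∈ Icc (3 * √3 / 2) √7) : arcSum d = pieceJE4 d :=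
  have hd : 0 < d := (by positivity : 0 < 3 * √3 / 2).trans_le h.1
  arcSum_eq_pieceJE4 hd (le_sq_of_le (by positivity) three_mul_sqrt_three_div_two_sq h.1)
    (sq_le_of_le hd (Real.sq_sqrt (by norm_num)) h.2)

theorem arcSum_of_mem_Icc5 {d : ℝ} (h : d ∈ Icc √7 3) : arcSum d = pieceJE5 d :=
  have hd : 0 < d := (by positivity : 0 < √7).trans_le h.1
  arcSum_eq_pieceJE5 hd (le_sq_of_le (by positivity) (Real.sq_sqrt (by norm_num)) h.1)
    (sq_le_of_le hd (by norm_num) h.2)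

theorem arcSum_of_mem_Icc6 {d : ℝ} (h : d ∈ Icc 3 (2 * √3)) : arcSum d = pieceJE6 d :=
  have hd : 0 < d := three_pos.trans_le h.1
  arcSum_eq_pieceJE6 hd (le_sq_of_le three_pos.le (by norm_num) h.1)
    (sq_le_of_le hd two_mul_sqrt_three_sq h.2)

theorem arcSum_of_mem_Icc7 {d : ℝ} (h : d ∈ Icc (2 * √3) √13) : arcSum d = pieceJE7 d :=
  have hd : 0 < d := (by positivity : 0 < 2 * √3).trans_le h.1
  arcSum_eq_pieceJE7 hd (le_sq_of_le (by positivity) two_mul_sqrt_three_sq h.1)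
    (sq_le_of_le hd (Real.sq_sqrt (by norm_num)) h.2)

theorem densityJE_eq_arcSum {d : ℝ} (hd : 0 < d) : densityJE d = 2 * d * arcSum d := by
  unfold densityJE
  split_ifs with h0 h1 h2 h3 h4 h5 h6 h7
  · rw [arcSum_eq_zero hd (.inl (by nlinarith)), mul_zero]
  · rw [arcSum_of_mem_Icc1 ⟨not_lt.1 h0, h1⟩]
  · rw [arcSum_of_mem_Icc2 ⟨(not_le.1 h1).le, h2⟩]
  · rw [arcSum_of_mem_Icc3 ⟨(not_le.1 h2).le, h3⟩]
  · rw [arcSum_of_mem_Icc4 ⟨(not_le.1 h3).le, h4⟩]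
  · rw [arcSum_of_mem_Icc5 ⟨(not_le.1 h4).le, h5⟩]
  · rw [arcSum_of_mem_Icc6 ⟨(not_le.1 h5).le, h6⟩]
  · rw [arcSum_of_mem_Icc7 ⟨(not_le.1 h6).le, h7⟩]
  · rw [arcSum_eq_zero hd (.inr ((Real.sqrt_lt' hd).1 (not_le.1 h7))), mul_zero]

theorem densityJE_of_lt_one {d : ℝ} (hd : d < 1) : densityJE d = 0 := if_pos hd

theorem densityJE_nonneg (d : ℝ) : 0 ≤ densityJE d := by
  rcases le_or_gt d 0 with hd | hd
  · rw [densityJE_of_lt_one (by linarith)]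
  · rw [densityJE_eq_arcSum hd]
    have := arcSum_nonneg hd
    positivity

theorem densityJE_of_notMem {d : ℝ} (hd : d ∉ Icc 1 √13) : densityJE d = 0 := by
  rcases lt_or_ge d 1 with h | h
  · exact densityJE_of_lt_one h
  · have h13 : √13 < d := not_le.1 fun h' => hd ⟨h, h'⟩
    have h0 : 0 < d := by linarith
    rw [densityJE_eq_arcSum h0, arcSum_eq_zero h0 (.inr ((Real.sqrt_lt' h0).1 h13)), mul_zero]

theorem measurable_densityJE : Measurable densityJE := by
  have h (c k : ℝ) : Measurable fun d : ℝ => Real.arcsin (c / (k * d)) :=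
    Real.measurable_arcsin.comp (by fun_prop)
  have h' (c : ℝ) : Measurable fun d : ℝ => Real.arcsin (c / d) :=
    Real.measurable_arcsin.comp (by fun_prop)
  have s (c k : ℝ) : Measurable fun d : ℝ => √(c * d ^ 2 - k) := by fun_prop
  unfold densityJE pieceJE1 pieceJE2 pieceJE3 pieceJE4 pieceJE5 pieceJE6 pieceJE7
  refine Measurable.ite measurableSet_Iio (by fun_prop) ?_
  refine Measurable.ite measurableSet_Iic (by fun_prop) ?_
  refine Measurable.ite measurableSet_Iic (by fun_prop) ?_
  refine Measurable.ite measurableSet_Iic (by fun_prop) ?_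
  refine Measurable.ite measurableSet_Iic (by fun_prop) ?_
  refine Measurable.ite measurableSet_Iic (by fun_prop) ?_
  refine Measurable.ite measurableSet_Iic (by fun_prop) ?_
  exact Measurable.ite measurableSet_Iic (by fun_prop) (by fun_prop)

/-! ### Joint law of the oblique coordinates, by Tonelli -/

/-- The uniform distribution on the unit interval. -/
noncomputable def unitUniform : Measure ℝ := volume.restrict (Ioo 0 1)

/-- The indicator function of the open unit interval. -/
noncomputable def unitIndicator (x : ℝ) : ENNReal := (Ioo (0 : ℝ) 1).indicator 1 x

instance : IsProbabilityMeasure unitUniform := ⟨by simp [unitUniform]⟩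

theorem measurable_unitIndicator : Measurable unitIndicator :=
  measurable_one.indicator measurableSet_Ioo

theorem lintegral_unitUniform (f : ℝ → ENNReal) :
    ∫⁻ x, f x ∂unitUniform = ∫⁻ x, unitIndicator x * f x := by
  rw [unitUniform, ← lintegral_indicator measurableSet_Ioo]
  refine lintegral_congr fun x => ?_
  by_cases hx : x ∈ Ioo (0 : ℝ) 1 <;> simp [unitIndicator, hx]

theorem lintegral_unitUniform_add (f : ℝ → ENNReal) (c : ℝ) :
    ∫⁻ x, f (x + c) ∂unitUniform = ∫⁻ x, unitIndicator (x - c) * f x := by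
  rw [lintegral_unitUniform,
    ← lintegral_add_right_eq_self (fun x => unitIndicator (x - c) * f x) c]
  simp only [add_sub_cancel_right]

theorem ofReal_hat_eq (x : ℝ) :
    ENNReal.ofReal (hat x) = ∫⁻ s, unitIndicator (x + s) ∂unitUniform := by
  have h : (fun s => unitIndicator (x + s)) = (Ioo (-x) (1 - x)).indicator 1 := by
    ext s
    have : x + s ∈ Ioo (0 : ℝ) 1 ↔ s ∈ Ioo (-x) (1 - x) := by
      simp only [mem_Ioo]; constructor <;> rintro ⟨h1, h2⟩ <;> constructor <;> linarith
    by_cases hs : s ∈ Ioo (-x) (1 - x)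
    · simp [unitIndicator, this.2 hs, hs]
    · simp [unitIndicator, mt this.1 hs, hs]
  -- The value is the length of the overlap of `(-x, 1 - x)` with the unit interval.
  rw [h, lintegral_indicator_one measurableSet_Ioo, unitUniform,
    Measure.restrict_apply measurableSet_Ioo, Ioo_inter_Ioo, Real.volume_Ioo, hat]
  rcases le_total x 0 with hx | hx
  · rw [min_eq_left (by linarith : 1 + x ≤ 1 - x), max_eq_left (by linarith : (0 : ℝ) ≤ -x),
      min_eq_right (by linarith : (1 : ℝ) ≤ 1 - x), sub_neg_eq_add, ENNReal.ofReal_max,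
      ENNReal.ofReal_zero, max_eq_left zero_le]
  · rw [min_eq_right (by linarith : 1 - x ≤ 1 + x), max_eq_right (by linarith : -x ≤ (0 : ℝ)),
      min_eq_left (by linarith : 1 - x ≤ (1 : ℝ)), sub_zero, ENNReal.ofReal_max,
      ENNReal.ofReal_zero, max_eq_left zero_le]

theorem lintegral_unitUniform_sub {g : ℝ → ENNReal} (hg : Measurable g) :
    ∫⁻ s, ∫⁻ t, g (t - s) ∂unitUniform ∂unitUniform = ∫⁻ x, ENNReal.ofReal (hat x) * g x := by
  have h (s : ℝ) : ∫⁻ t, g (t - s) ∂unitUniform = ∫⁻ x, unitIndicator (x + s) * g x := by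
    simpa only [sub_eq_add_neg, neg_neg] using lintegral_unitUniform_add g (-s)
  have hm := measurable_unitIndicator
  simp only [h]
  rw [lintegral_lintegral_swap (by unfold Function.uncurry; fun_prop)]
  refine lintegral_congr fun x => ?_
  rw [ofReal_hat_eq, lintegral_mul_const _ (by fun_prop)]

theorem ofReal_diffDensity_eq (a b : ℝ) :
    ENNReal.ofReal (diffDensity a b)
      = ∫⁻ t, unitIndicator (a - 1 - t) * ENNReal.ofReal (hat (b + 1 - t)) ∂unitUniform := by
  have h : (fun t => unitIndicator (a - 1 - t) * ENNReal.ofReal (hat (b + 1 - t)))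
      = (Ioo (a - 2) (a - 1)).indicator fun t => ENNReal.ofReal (hat (b + 1 - t)) := by
    ext t
    have : a - 1 - t ∈ Ioo (0 : ℝ) 1 ↔ t ∈ Ioo (a - 2) (a - 1) := by
      simp only [mem_Ioo]; constructor <;> rintro ⟨h1, h2⟩ <;> constructor <;> linarith
    by_cases hs : t ∈ Ioo (a - 2) (a - 1)
    · simp [unitIndicator, this.2 hs, hs]
    · simp [unitIndicator, mt this.1 hs, hs]
  have hc : Continuous fun t => hat (b + 1 - t) := continuous_hat.comp (by fun_prop)
  have hpq : unitClamp (a - 2) ≤ unitClamp (a - 1) := monotone_unitClamp (by linarith)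
  rw [h, lintegral_indicator measurableSet_Ioo, unitUniform,
    Measure.restrict_restrict measurableSet_Ioo, diffDensity, ← integral_hat_sub,
    intervalIntegral.integral_of_le hpq, integral_Ioc_eq_integral_Ioo,
    ofReal_integral_eq_lintegral_ofReal (hc.integrableOn_Ioc.mono_set Ioo_subset_Ioc_self)
      (Filter.Eventually.of_forall fun _ => hat_nonneg _)]
  congr 2
  rw [Ioo_inter_Ioo]
  rcases le_or_gt a 1 with h1 | h1
  · rw [unitClamp_of_nonpos (by linarith), unitClamp_of_nonpos (by linarith), Ioo_self,
      Ioo_eq_empty]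
    exact not_lt.2 ((min_le_left _ _).trans ((by linarith : a - 1 ≤ 0).trans (le_max_right _ _)))
  rcases le_or_gt 3 a with h3 | h3
  · rw [unitClamp_of_one_le (by linarith), unitClamp_of_one_le (by linarith), Ioo_self,
      Ioo_eq_empty]
    exact not_lt.2 ((min_le_right _ _).trans ((by linarith : 1 ≤ a - 2).trans (le_max_left _ _)))
  · unfold unitClamp
    rw [min_eq_right (by linarith : a - 2 ≤ 1), max_comm, max_eq_right (a := (0 : ℝ)), min_comm]
    exact le_min zero_le_one (by linarith)

/-- `t'` is the only variable shared by the two coordinates, so it is kept outermost. For fixed `t'`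
the variables `s'` and `t` yield `hat` and `s` yields an indicator; `t'` is then moved inside, where
`ofReal_diffDensity_eq` integrates it out. -/
theorem lintegral_four_unitUniform {G : ℝ → ℝ → ENNReal} (hG : Measurable (Function.uncurry G)) :
    ∫⁻ t', ∫⁻ s, ∫⁻ s', ∫⁻ t, G (1 + s + t') (t - s' + t' - 1)
        ∂unitUniform ∂unitUniform ∂unitUniform ∂unitUniform
      = ∫⁻ a, ∫⁻ b, ENNReal.ofReal (diffDensity a b) * G a b := by
  have hm := measurable_unitIndicator
  have hh := continuous_hat.measurable
  have h1 (a t' : ℝ) : ∫⁻ s', ∫⁻ t, G a (t - s' + t' - 1) ∂unitUniform ∂unitUniform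
      = ∫⁻ b, ENNReal.ofReal (hat (b + 1 - t')) * G a b := by
    have hGa : Measurable (G a) := hG.comp measurable_prodMk_left
    rw [lintegral_unitUniform_sub (g := fun x => G a (x + t' - 1)) (by fun_prop),
      ← lintegral_add_right_eq_self (fun b => ENNReal.ofReal (hat (b + 1 - t')) * G a b) (t' - 1)]
    refine lintegral_congr fun x => ?_
    congr 3 <;> ring
  have h2 (t' : ℝ) : ∫⁻ s, (∫⁻ b, ENNReal.ofReal (hat (b + 1 - t')) * G (1 + s + t') b) ∂unitUniform
      = ∫⁻ a, ∫⁻ b, unitIndicator (a - 1 - t') * ENNReal.ofReal (hat (b + 1 - t')) * G a b := by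
    have := lintegral_unitUniform_add
      (fun a => ∫⁻ b, ENNReal.ofReal (hat (b + 1 - t')) * G a b) (1 + t')
    simp only [add_left_comm _ (1 : ℝ), ← add_assoc, ← sub_sub] at this
    rw [this]
    refine lintegral_congr fun a => ?_
    have hGa : Measurable (G a) := hG.comp measurable_prodMk_left
    rw [← lintegral_const_mul _ (by fun_prop)]
    simp only [mul_assoc]
  simp only [h1, h2]
  rw [lintegral_lintegral_swap]
  swap
  · refine (Measurable.lintegral_prod_right' (f := fun p : (ℝ × ℝ) × ℝ =>
      unitIndicator (p.1.2 - 1 - p.1.1) * ENNReal.ofReal (hat (p.2 + 1 - p.1.1))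
        * G p.1.2 p.2) ?_).aemeasurable
    have : Measurable fun p : (ℝ × ℝ) × ℝ => G p.1.2 p.2 :=
      hG.comp ((measurable_snd.comp measurable_fst).prodMk measurable_snd)
    fun_prop
  refine lintegral_congr fun a => ?_
  have hGa : Measurable (G a) := hG.comp measurable_prodMk_left
  rw [lintegral_lintegral_swap (by unfold Function.uncurry; fun_prop)]
  refine lintegral_congr fun b => ?_
  rw [lintegral_mul_const _ (by fun_prop), ofReal_diffDensity_eq]

/-! ### Passage to polar coordinates -/

theorem setLIntegral_eq_of_subset_of_forall_diff_eq_zero {s t : Set ℝ} {f : ℝ → ENNReal}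
    (hs : MeasurableSet s) (ht : MeasurableSet t) (hst : s ⊆ t) (h : ∀ x ∈ t \ s, f x = 0) :
    ∫⁻ x in t, f x = ∫⁻ x in s, f x := by
  rw [← lintegral_indicator ht, ← lintegral_indicator hs]
  refine lintegral_congr fun x => ?_
  by_cases hxs : x ∈ s
  · rw [indicator_of_mem hxs, indicator_of_mem (hst hxs)]
  by_cases hxt : x ∈ t
  · rw [indicator_of_notMem hxs, indicator_of_mem hxt, h x ⟨hxt, hxs⟩]
  · rw [indicator_of_notMem hxs, indicator_of_notMem hxt]

theorem lintegral_angle_diffDensity {r : ℝ} (hr : 0 < r) :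
    ∫⁻ θ in Ioo (-Real.pi) Real.pi, ENNReal.ofReal (diffDensity (2 * r / √3 * Real.sin θ)
      (2 * r / √3 * Real.sin (θ + Real.pi / 3))) = ENNReal.ofReal (√3 * arcSum r) := by
  have hc : Continuous fun θ => diffDensity (2 * r / √3 * Real.sin θ)
      (2 * r / √3 * Real.sin (θ + Real.pi / 3)) :=
    continuous_diffDensity.comp (f := fun θ => (2 * r / √3 * Real.sin θ,
      2 * r / √3 * Real.sin (θ + Real.pi / 3))) (by fun_prop)
  have hpi := Real.pi_pos
  rw [← integral_diffDensity hr, intervalIntegral.integral_of_le hpi.le,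
    integral_Ioc_eq_integral_Ioo, ofReal_integral_eq_lintegral_ofReal
      (hc.integrableOn_Ioc.mono_set Ioo_subset_Ioc_self)
      (Filter.Eventually.of_forall fun _ => diffDensity_nonneg _ _)]
  refine setLIntegral_eq_of_subset_of_forall_diff_eq_zero measurableSet_Ioo measurableSet_Ioo
    (Ioo_subset_Ioo_left (by linarith)) fun θ hθ => ?_
  rw [ENNReal.ofReal_eq_zero]
  by_contra! hne
  have h1 := (diffDensity_support hne.ne').1
  have h0 : θ ≤ 0 := by
    by_contra! h
    exact hθ.2 ⟨h, hθ.1.2⟩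
  have : Real.sin θ ≤ 0 := Real.sin_nonpos_of_nonpos_of_neg_pi_le h0 hθ.1.1.le
  have : 2 * r / √3 * Real.sin θ ≤ 0 := mul_nonpos_of_nonneg_of_nonpos (by positivity) this
  linarith

theorem lintegral_eq_ofReal_mul_lintegral_comp_mul {c : ℝ} (hc : 0 < c) {f : ℝ → ENNReal}
    (hf : Measurable f) : ∫⁻ x, f x = ENNReal.ofReal c * ∫⁻ x, f (c * x) := by
  conv_lhs => rw [← Real.smul_map_volume_mul_left hc.ne']
  rw [lintegral_smul_measure, lintegral_map hf (by fun_prop), abs_of_pos hc, smul_eq_mul]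

theorem measurable_diffDensity_comp {α : Type*} [MeasurableSpace α] {g h : α → ℝ}
    (hg : Measurable g) (hh : Measurable h) : Measurable fun x => diffDensity (g x) (h x) :=
  Measurable.comp (g := fun p : ℝ × ℝ => diffDensity p.1 p.2) (f := fun x => (g x, h x))
    continuous_diffDensity.measurable (hg.prodMk hh)

theorem measurable_cartesian_integrand {f : ℝ → ENNReal} (hf : Measurable f) :
    Measurable fun p : ℝ × ℝ => ENNReal.ofReal (diffDensity (2 / √3 * p.2)
      (p.1 + 2 / √3 * p.2 / 2)) * f √(p.1 ^ 2 + 3 / 4 * (2 / √3 * p.2) ^ 2) :=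
  (measurable_diffDensity_comp (by fun_prop) (by fun_prop)).ennreal_ofReal.mul
    (hf.comp (by fun_prop))

/-- Completing the square by the shift `a / 2` and rescaling `a` makes the coordinates orthonormal;
`2 / √3` is the Jacobian. -/
theorem lintegral_diffDensity_cartesian {f : ℝ → ENNReal} (hf : Measurable f) :
    ∫⁻ a, ∫⁻ b, ENNReal.ofReal (diffDensity a b) * f √((b - a / 2) ^ 2 + 3 / 4 * a ^ 2)
      = ENNReal.ofReal (2 / √3) * ∫⁻ p : ℝ × ℝ, ENNReal.ofReal (diffDensity (2 / √3 * p.2)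
        (p.1 + 2 / √3 * p.2 / 2)) * f √(p.1 ^ 2 + 3 / 4 * (2 / √3 * p.2) ^ 2) := by
  have h1 (a : ℝ) : ∫⁻ b, ENNReal.ofReal (diffDensity a b)
        * f √((b - a / 2) ^ 2 + 3 / 4 * a ^ 2)
      = ∫⁻ x, ENNReal.ofReal (diffDensity a (x + a / 2)) * f √(x ^ 2 + 3 / 4 * a ^ 2) := by
    rw [← lintegral_add_right_eq_self _ (a / 2)]
    simp only [add_sub_cancel_right]
  have hm : Measurable fun p : ℝ × ℝ => ENNReal.ofReal (diffDensity p.1 (p.2 + p.1 / 2))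
      * f √(p.2 ^ 2 + 3 / 4 * p.1 ^ 2) :=
    (measurable_diffDensity_comp (by fun_prop) (by fun_prop)).ennreal_ofReal.mul
      (hf.comp (by fun_prop))
  simp only [h1]
  rw [lintegral_eq_ofReal_mul_lintegral_comp_mul (c := 2 / √3) (by positivity)
    hm.lintegral_prod_right', Measure.volume_eq_prod,
    lintegral_prod_symm _ (measurable_cartesian_integrand hf).aemeasurable]

theorem polar_integrand_eq (f : ℝ → ENNReal) {r : ℝ} (hr : 0 < r) (θ : ℝ) :
    ENNReal.ofReal r • (ENNReal.ofReal (diffDensity (2 / √3 * (r * Real.sin θ))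
        (r * Real.cos θ + 2 / √3 * (r * Real.sin θ) / 2))
      * f √((r * Real.cos θ) ^ 2 + 3 / 4 * (2 / √3 * (r * Real.sin θ)) ^ 2))
      = ENNReal.ofReal (diffDensity (2 * r / √3 * Real.sin θ)
          (2 * r / √3 * Real.sin (θ + Real.pi / 3))) * (ENNReal.ofReal r * f r) := by
  have e1 : 2 / √3 * (r * Real.sin θ) = 2 * r / √3 * Real.sin θ := by ring
  have e2 : r * Real.cos θ + 2 * r / √3 * Real.sin θ / 2
      = 2 * r / √3 * Real.sin (θ + Real.pi / 3) := by
    rw [Real.sin_add, Real.sin_pi_div_three, Real.cos_pi_div_three]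
    field_simp
    ring
  have e3 : (r * Real.cos θ) ^ 2 + 3 / 4 * (2 * r / √3 * Real.sin θ) ^ 2 = r ^ 2 := by
    have : (2 * r / √3 * Real.sin θ) ^ 2 = 4 * r ^ 2 * Real.sin θ ^ 2 / √3 ^ 2 := by ring
    rw [this, sqrt_three_sq]
    linear_combination r ^ 2 * Real.sin_sq_add_cos_sq θ
  rw [e1, e2, e3, Real.sqrt_sq hr.le, smul_eq_mul]
  ring

theorem lintegral_comp_polarCoord {F : ℝ × ℝ → ENNReal} (hF : Measurable F) :
    ∫⁻ p, F p = ∫⁻ r in Ioi 0, ∫⁻ θ in Ioo (-Real.pi) Real.pi,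
      ENNReal.ofReal r • F (r * Real.cos θ, r * Real.sin θ) := by
  rw [← lintegral_comp_polarCoord_symm, polarCoord_target, Measure.volume_eq_prod,
    ← Measure.prod_restrict, lintegral_prod]
  · simp only [polarCoord_symm_apply]
  · exact ((by fun_prop : Measurable fun p : ℝ × ℝ => ENNReal.ofReal p.1).mul
      (hF.comp continuous_polarCoord_symm.measurable)).aemeasurable

theorem lintegral_diffDensity {f : ℝ → ENNReal} (hf : Measurable f) :
    ∫⁻ a, ∫⁻ b, ENNReal.ofReal (diffDensity a b) * f √((b - a / 2) ^ 2 + 3 / 4 * a ^ 2)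
      = ∫⁻ r, ENNReal.ofReal (densityJE r) * f r := by
  have h4 : ∫⁻ r, ENNReal.ofReal (densityJE r) * f r
      = ∫⁻ r in Ioi 0, ENNReal.ofReal (densityJE r) * f r := by
    refine (setLIntegral_eq_of_support_subset fun r hr => ?_).symm
    by_contra hr0
    have : r ≤ 0 := not_lt.1 hr0
    exact hr (by simp only [densityJE_of_lt_one (by linarith : r < 1), ENNReal.ofReal_zero,
      zero_mul])
  rw [lintegral_diffDensity_cartesian hf,
    lintegral_comp_polarCoord (measurable_cartesian_integrand hf),
    ← lintegral_const_mul' _ _ ENNReal.ofReal_ne_top, h4]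
  refine setLIntegral_congr_fun measurableSet_Ioi fun r hr => ?_
  have hr0 : 0 < r := hr
  have hθ : Measurable fun θ => diffDensity (2 * r / √3 * Real.sin θ)
      (2 * r / √3 * Real.sin (θ + Real.pi / 3)) :=
    measurable_diffDensity_comp (by fun_prop) (by fun_prop)
  simp only [polar_integrand_eq f hr0]
  rw [lintegral_mul_const _ hθ.ennreal_ofReal, lintegral_angle_diffDensity hr0, ← mul_assoc,
    ← mul_assoc, ← ENNReal.ofReal_mul (by positivity), ← ENNReal.ofReal_mul
    (by have := arcSum_nonneg hr0; positivity), densityJE_eq_arcSum hr0]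
  -- The Jacobian `2 / √3` meets the factor `√3` of the angular integral, leaving `2 * r * arcSum
  -- r`.
  congr 2
  field_simp

/-! ### Uniform points of the rhombuses and the law of their distance -/

/-- An affine isomorphism carries Lebesgue measure to a multiple of Lebesgue measure, by uniqueness
of Haar measure. The multiple is found from total mass one, so no determinant is computed. -/
theorem cond_openParallelogram (p u v : Plane)
    (h : ∀ s t : ℝ, s • u + t • v = 0 → s = 0 ∧ t = 0) :
    ProbabilityTheory.cond volume (openParallelogram p u v)
      = (unitUniform.prod unitUniform).map fun x => p + x.1 • u + x.2 • v := by
  let f : ℝ × ℝ →ₗ[ℝ] Plane :=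
    (LinearMap.toSpanSingleton ℝ Plane u).coprod (LinearMap.toSpanSingleton ℝ Plane v)
  have hf (x : ℝ × ℝ) : f x = x.1 • u + x.2 • v := by simp [f]
  have hinj : Function.Injective f := by
    rw [← LinearMap.ker_eq_bot, LinearMap.ker_eq_bot']
    intro x hx
    rw [hf] at hx
    exact Prod.ext (h _ _ hx).1 (h _ _ hx).2
  let L : (ℝ × ℝ) ≃L[ℝ] Plane :=
    (LinearMap.linearEquivOfInjective f hinj (by simp)).toContinuousLinearEquiv
  have hL (x : ℝ × ℝ) : L x = x.1 • u + x.2 • v := hf x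
  let e : (ℝ × ℝ) ≃ᵐ Plane := (L.toHomeomorph.trans (Homeomorph.addLeft p)).toMeasurableEquiv
  have he (x : ℝ × ℝ) : e x = p + x.1 • u + x.2 • v := by
    rw [add_assoc, ← hL]; rfl
  have hpre : e ⁻¹' openParallelogram p u v = Ioo 0 1 ×ˢ Ioo 0 1 := by
    ext x
    constructor
    · rintro ⟨s, hs, t, ht, hx⟩
      have : x = (s, t) := e.injective (hx.trans (he (s, t)).symm)
      rw [this]
      exact ⟨hs, ht⟩
    · rintro ⟨h1, h2⟩
      exact ⟨x.1, h1, x.2, h2, he x⟩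
  have hmap : Measure.map e volume = Measure.addHaarScalarFactor (Measure.map L volume) volume •
      (volume : Measure Plane) := by
    have : Measure.map e volume = Measure.map (fun x => p + x) (Measure.map L volume) := by
      rw [Measure.map_map (by fun_prop) (by fun_prop)]; rfl
    rw [this, map_add_left_eq_self]
    exact Measure.isAddLeftInvariant_eq_smul _ _
  have hmain : (unitUniform.prod unitUniform).map (fun x => p + x.1 • u + x.2 • v)
      = Measure.addHaarScalarFactor (Measure.map L volume) volume •
        (volume : Measure Plane).restrict (openParallelogram p u v) := by
    rw [unitUniform, Measure.prod_restrict, ← Measure.volume_eq_prod, ← hpre,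
      ← Measure.restrict_smul, ← hmap, MeasurableEquiv.restrict_map]
    congr 1
    ext1 x; exact (he x).symm
  have hprob : IsProbabilityMeasure
      ((unitUniform.prod unitUniform).map fun x => p + x.1 • u + x.2 • v) :=
    Measure.isProbabilityMeasure_map (by fun_prop)
  rw [hmain] at hprob ⊢
  have h1 := hprob.measure_univ
  rw [Measure.smul_apply, Measure.restrict_apply_univ] at h1
  rw [ProbabilityTheory.cond, ← ENNReal.eq_inv_of_mul_eq_one_left h1]
  rfl

theorem edge2_edge0_independent (s t : ℝ) (h : s • edge2 + t • edge0 = 0) : s = 0 ∧ t = 0 := by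
  have h0 := congrArg (fun x : Plane => x 0) h
  have h1 := congrArg (fun x : Plane => x 1) h
  simp [edge2, edge0] at h0 h1
  subst h1
  simpa using h0

theorem edge0_edge1_independent (s t : ℝ) (h : s • edge0 + t • edge1 = 0) : s = 0 ∧ t = 0 := by
  have h0 := congrArg (fun x : Plane => x 0) h
  have h1 := congrArg (fun x : Plane => x 1) h
  simp [edge1, edge0] at h0 h1
  subst h1
  simpa using h0

theorem dist_rhombus_points (s t s' t' : ℝ) :
    dist (centre₁ + s • edge2 + t • edge0) (centre₂ + s' • edge0 + t' • edge1)
      = √((t - s' + t' - 1 - (1 + s + t') / 2) ^ 2 + 3 / 4 * (1 + s + t') ^ 2) := by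
  rw [EuclideanSpace.dist_eq]
  congr 1
  simp [centre₁, centre₂, edge0, edge1, edge2, Real.dist_eq, sq_abs]
  linear_combination (1 / 4 * (1 + s + t') ^ 2) * sqrt_three_sq

theorem map_dist_eq_withDensity {Ω : Type*} [MeasurableSpace Ω] (P : Measure Ω)
    [IsProbabilityMeasure P] {X Y : Ω → Plane}
    (hX : pdf.IsUniform X rhombusJ P volume) (hY : pdf.IsUniform Y rhombusE P volume)
    (hXY : ProbabilityTheory.IndepFun X Y P) :
    AEMeasurable (fun ω => dist (X ω) (Y ω)) P ∧
    P.map (fun ω => dist (X ω) (Y ω))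
      = volume.withDensity fun d => ENNReal.ofReal (densityJE d) := by
  rw [pdf.IsUniform, rhombusJ, cond_openParallelogram _ _ _ edge2_edge0_independent] at hX
  rw [pdf.IsUniform, rhombusE, cond_openParallelogram _ _ _ edge0_edge1_independent] at hY
  have mJ : Measurable fun x : ℝ × ℝ => centre₁ + x.1 • edge2 + x.2 • edge0 := by fun_prop
  have mE : Measurable fun x : ℝ × ℝ => centre₂ + x.1 • edge0 + x.2 • edge1 := by fun_prop
  have pJ := Measure.isProbabilityMeasure_map (μ := unitUniform.prod unitUniform) mJ.aemeasurable
  have pE := Measure.isProbabilityMeasure_map (μ := unitUniform.prod unitUniform) mE.aemeasurable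
  -- The pushforward along a map that is not almost everywhere measurable is zero by convention,
  -- whereas here it is a probability measure.
  have aX : AEMeasurable X P := aemeasurable_of_map_neZero (by rw [hX]; infer_instance)
  have aY : AEMeasurable Y P := aemeasurable_of_map_neZero (by rw [hY]; infer_instance)
  refine ⟨aX.dist aY, ?_⟩
  have hprod := (ProbabilityTheory.indepFun_iff_map_prod_eq_prod_map_map aX aY).1 hXY
  have hd : Measurable fun p : Plane × Plane => dist p.1 p.2 := by fun_prop
  have hcomp : P.map (fun ω => dist (X ω) (Y ω))
      = (P.map fun ω => (X ω, Y ω)).map fun p => dist p.1 p.2 := by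
    rw [AEMeasurable.map_map_of_aemeasurable hd.aemeasurable (aX.prodMk aY)]; rfl
  rw [hcomp, hprod, hX, hY, Measure.map_prod_map _ _ mJ mE, Measure.map_map hd (mJ.prodMap mE)]
  refine Measure.ext_of_lintegral _ fun f hf => ?_
  rw [lintegral_withDensity_eq_lintegral_mul _ measurable_densityJE.ennreal_ofReal hf,
    lintegral_map hf (hd.comp (mJ.prodMap mE))]
  simp only [Function.comp_def, Prod.map, dist_rhombus_points, Pi.mul_apply]
  rw [← lintegral_diffDensity hf, ← lintegral_four_unitUniform
    (G := fun a b => f √((b - a / 2) ^ 2 + 3 / 4 * a ^ 2)) (hf.comp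
      (by fun_prop : Measurable fun q : ℝ × ℝ => √((q.2 - q.1 / 2) ^ 2 + 3 / 4 * q.1 ^ 2)))]
  have hF : Measurable fun q : (ℝ × ℝ) × ℝ × ℝ => f √((q.1.2 - q.2.1 + q.2.2 - 1
      - (1 + q.1.1 + q.2.2) / 2) ^ 2 + 3 / 4 * (1 + q.1.1 + q.2.2) ^ 2) := hf.comp (by fun_prop)
  -- The product integral is unfolded with `t'` outermost, then `s'`; exchanging `s` and `s'` on the
  -- other side makes the orders agree.
  rw [lintegral_prod_symm _ hF.aemeasurable,
    lintegral_prod_symm _ hF.lintegral_prod_left'.aemeasurable]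
  refine lintegral_congr fun t' => ?_
  have hF2 : Measurable fun q : (ℝ × ℝ) × ℝ => f √((q.2 - q.1.2 + t' - 1
      - (1 + q.1.1 + t') / 2) ^ 2 + 3 / 4 * (1 + q.1.1 + t') ^ 2) := hf.comp (by fun_prop)
  conv_rhs => rw [lintegral_lintegral_swap hF2.lintegral_prod_right'.aemeasurable]
  refine lintegral_congr fun s' => ?_
  exact lintegral_prod _ (hF.comp (measurable_prodMk_right (y := (s', t')))).aemeasurable

theorem mainTheorem7 {Ω : Type*} [MeasurableSpace Ω] (P : MeasureTheory.Measure Ω)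
    [MeasureTheory.IsProbabilityMeasure P] (X Y : Ω → Plane)
    (hX : MeasureTheory.pdf.IsUniform X rhombusJ P MeasureTheory.volume)
    (hY : MeasureTheory.pdf.IsUniform Y rhombusE P MeasureTheory.volume)
    (hXY : ProbabilityTheory.IndepFun X Y P) :
    MeasureTheory.HasPDF (fun ω => dist (X ω) (Y ω)) P MeasureTheory.volume ∧
    MeasureTheory.pdf (fun ω => dist (X ω) (Y ω)) P MeasureTheory.volume
      =ᵐ[MeasureTheory.volume] (fun d => ENNReal.ofReal (densityJE d)) ∧
    (∀ d, 0 ≤ densityJE d) ∧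
    (∀ d ∈ Set.Icc 1 (√3), densityJE d = 2 * d * pieceJE1 d) ∧
    (∀ d ∈ Set.Icc (√3) 2, densityJE d = 2 * d * pieceJE2 d) ∧
    (∀ d ∈ Set.Icc 2 (3 * √3 / 2), densityJE d = 2 * d * pieceJE3 d) ∧
    (∀ d ∈ Set.Icc (3 * √3 / 2) (√7), densityJE d = 2 * d * pieceJE4 d) ∧
    (∀ d ∈ Set.Icc (√7) 3, densityJE d = 2 * d * pieceJE5 d) ∧
    (∀ d ∈ Set.Icc 3 (2 * √3), densityJE d = 2 * d * pieceJE6 d) ∧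
    (∀ d ∈ Set.Icc (2 * √3) (√13), densityJE d = 2 * d * pieceJE7 d) ∧
    (∀ d, d ∉ Set.Icc 1 (√13) → densityJE d = 0) := by
  obtain ⟨hD, hmap⟩ := map_dist_eq_withDensity P hX hY hXY
  have hm := measurable_densityJE.ennreal_ofReal.aemeasurable (μ := MeasureTheory.volume)
  have hpdf := MeasureTheory.hasPDF_of_map_eq_withDensity hD _ hm hmap
  refine ⟨hpdf, (MeasureTheory.pdf.eq_of_map_eq_withDensity _ hm).1 hmap, densityJE_nonneg,
    fun d h => ?_, fun d h => ?_, fun d h => ?_, fun d h => ?_, fun d h => ?_, fun d h => ?_,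
    fun d h => ?_, fun d h => densityJE_of_notMem h⟩
  · rw [densityJE_eq_arcSum (one_pos.trans_le h.1), arcSum_of_mem_Icc1 h]
  · rw [densityJE_eq_arcSum ((by positivity : 0 < √3).trans_le h.1), arcSum_of_mem_Icc2 h]
  · rw [densityJE_eq_arcSum (two_pos.trans_le h.1), arcSum_of_mem_Icc3 h]
  · rw [densityJE_eq_arcSum ((by positivity : 0 < 3 * √3 / 2).trans_le h.1), arcSum_of_mem_Icc4 h]
  · rw [densityJE_eq_arcSum ((by positivity : 0 < √7).trans_le h.1), arcSum_of_mem_Icc5 h]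
  · rw [densityJE_eq_arcSum (three_pos.trans_le h.1), arcSum_of_mem_Icc6 h]
  · rw [densityJE_eq_arcSum ((by positivity : 0 < 2 * √3).trans_le h.1), arcSum_of_mem_Icc7 h]
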